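/- Let $X$ be a smooth manifold of dimension $n$, let $f:X\to\mathbb R$ be smooth, let $x_0\in X$ with $f(x_0)=0$, and suppose that $f$ has a local extremum at $x_0$. Fix local coordinates near $x_0$, let $\rho>0$ be the smooth density of the measure $dx$ of $X$ with respect to Lebesgue measure in these coordinates (so $\rho\equiv1$ if $dx$ is Lebesgue measure there), and suppose that in these coordinates $$f(x)=f_k(x-x_0)+\mathcal O(\|x-x_0\|^{k+1}),\qquad x\to x_0,$$ where $k\ge 2$ and $f_k\neq0$ is a homogeneous polynomial of degree $k$ which is definite, i.e. $f_k(v)\ne 0$ for all $v\neq 0$. Then $k$ is even, and there is a neighbourhood $U$ of $x_0$ with the following property. Let $g:\mathbb R\times X\to\mathbb R$ be a smooth symbol, i.e. in every chart, for all $N\in\mathbb N$, all multi-indices $\alpha$ and all compact sets $K$ of the chart, $\sup_{t\in\mathbb R,\,x\in K}|t|^N|\partial_x^\alpha g(t,x)|<\infty$. Let $\Theta\in C_0^\infty(X)$ with $\operatorname{supp}\Theta\subset U$ and $\Theta=1$ near $x_0$. Put $$I_s(z)=\int_X g(zf(x),x)\,\Theta(x)\,dx .$$ Then there are $c_j\in\mathbb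 R$ with the full asymptotic expansion $$I_s(z)\sim\sum_{j\in\mathbb N}c_j z^{-j/k},\qquad z\to+\infty,$$ that is, $I_s(z)-\sum_{j<J}c_jz^{-j/k}=\mathcal O(z^{-J/k})$ for all $J\in\mathbb N$. Moreover $$I_s(z)=z^{-\frac nk}\Big\langle t_e^{\frac{n-k}{k}},g(t,x_0)\Big\rangle\,\frac{\rho(x_0)}{k}\int_{\mathbb S^{n-1}}|f_k(\theta)|^{-\frac nk}\,d\theta+\mathcal O\big(z^{-\frac{n+1}{k}}\big),$$ where $t_e=\max(t,0)$ if $x_0$ is a local minimum and $t_e=\max(-t,0)$ if $x_0$ is a local maximum, i.e. $\langle t_e^{a},h\rangle=\int_0^\infty t^{a}h(\pm t)\,dt$ with the sign $+$ for a minimum and $-$ for a maximum; the integral defining this pairing and the integral over the sphere converge absolutely. -/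

import Mathlib

open Set Filter MeasureTheory
open scoped Topology Manifold ContDiff

noncomputable section

/-- The measure `μ` on `X` is given, in the chart `φ`, by the smooth positive density `ρ`
with respect to Lebesgue measure: `dμ = ρ(y) dy` on the range of `φ`. -/
def IsChartDensity {n : ℕ} {X : Type*} [TopologicalSpace X] [MeasurableSpace X]
    (φ : OpenPartialHomeomorph X (EuclideanSpace ℝ (Fin n))) (μ : Measure X)
    (ρ : EuclideanSpace ℝ (Fin n) → ℝ) : Prop :=
  ContDiffOn ℝ ∞ ρ φ.target ∧ (∀ y ∈ φ.target, 0 < ρ y) ∧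
    (μ.restrict φ.source).map φ =
      (volume.restrict φ.target).withDensity (fun y => ENNReal.ofReal (ρ y))

/-- `g : ℝ × X → ℝ` is a symbol: it is smooth, and in every chart of `X` all the derivatives of
`g(t, ·)` decrease faster than any power of `t`, locally uniformly in `X`. -/
def IsSymbol (n : ℕ) {X : Type*} [TopologicalSpace X]
    [ChartedSpace (EuclideanSpace ℝ (Fin n)) X] (g : ℝ × X → ℝ) : Prop :=
  ContMDiff (𝓘(ℝ, ℝ).prod (𝓡 n)) 𝓘(ℝ, ℝ) ∞ g ∧
    ∀ φ ∈ IsManifold.maximalAtlas (𝓡 n) ∞ X, ∀ K : Set (EuclideanSpace ℝ (Fin n)),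
      IsCompact K → K ⊆ φ.target → ∀ N m : ℕ, ∃ C : ℝ, ∀ t : ℝ, ∀ y ∈ K,
        |t| ^ N * ‖iteratedFDeriv ℝ m (fun y' => g (t, φ.symm y')) y‖ ≤ C

/-- In the chart `φ` the germ of `f` at `x₀` is
`f(x) = p(x - x₀) + O(‖x - x₀‖ ^ (k + 1))`, where `p` is a nonzero homogeneous polynomial of
degree `k`. -/
def HasLeadingJet {n : ℕ} {X : Type*} [TopologicalSpace X]
    (φ : OpenPartialHomeomorph X (EuclideanSpace ℝ (Fin n))) (f : X → ℝ) (x₀ : X) (k : ℕ)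
    (p : MvPolynomial (Fin n) ℝ) : Prop :=
  p.IsHomogeneous k ∧ p ≠ 0 ∧
    (fun y => f (φ.symm y) - MvPolynomial.eval (fun i => (y - φ x₀) i) p)
      =O[𝓝 (φ x₀)] fun y => ‖y - φ x₀‖ ^ (k + 1)

/-- The singular part `∫ g(z f(x), x) Θ(x) dx`. -/
def singularPart {X : Type*} [MeasurableSpace X] (μ : Measure X) (f : X → ℝ) (g : ℝ × X → ℝ)
    (Θ : X → ℝ) (z : ℝ) : ℝ :=
  ∫ x, g (z * f x, x) * Θ x ∂μ

/-- The pairing `⟨t₊ ^ a, h⟩`, for `a > -1`. -/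
def pairingPlus (a : ℝ) (h : ℝ → ℝ) : ℝ := ∫ t in Ioi (0 : ℝ), t ^ a * h t

/-- The pairing `⟨t₋ ^ a, h⟩`, for `a > -1`. -/
def pairingMinus (a : ℝ) (h : ℝ → ℝ) : ℝ := ∫ t in Iio (0 : ℝ), (-t) ^ a * h t

/-- `∫ |p(θ)| ^ (-n/k) dθ` over the unit sphere of `ℝⁿ` with its surface measure. -/
def sphereIntegral {n : ℕ} (k : ℕ) (p : MvPolynomial (Fin n) ℝ) : ℝ :=
  ∫ θ : Metric.sphere (0 : EuclideanSpace ℝ (Fin n)) 1,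
    |MvPolynomial.eval (fun i => (θ : EuclideanSpace ℝ (Fin n)) i) p| ^ (-(n : ℝ) / k)
    ∂(volume : Measure (EuclideanSpace ℝ (Fin n))).toSphere

/-- `I(z) ∼ ∑ⱼ cⱼ z ^ (-j/k)` as `z → ∞`. -/
def HasAsymptoticExpansion (k : ℕ) (I : ℝ → ℝ) (c : ℕ → ℝ) : Prop :=
  ∀ J : ℕ, (fun z => I z - ∑ j ∈ Finset.range J, c j * z ^ (-(j : ℝ) / k))
    =O[atTop] fun z => z ^ (-(J : ℝ) / k)

end

/-! In coordinates centred at `x₀`, replacing `f` by `-f` and `g(t, ·)` by `g(-t, ·)` at a maximum,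
the phase is `F` with leading part `P` positive definite. Along the ray of direction `θ` one has
`F(rθ) = r ^ k (P θ + O(r))`, so near `0` the root `s = F ^ (1/k)` is increasing in `r` and
comparable to `r`. With `x = z ^ (-1/k)` the argument of the symbol is `z F = (s / x) ^ k`, and
polar coordinates leave integrals of `u((s / x) ^ k, r) r ^ m` in `r`, starting with `m = n - 1`.

These are expanded in powers of `x` without inverting `s`. Let `W = (s / r) ^ m s'`, so that `r ^ m
W = s ^ m s'`, and let `l(t)` be the limit of `u(t, r) / W(r)` as `r → 0`. The part `l(t) W(r)` of
`u` is integrated exactly by the substitution `σ = s / x`: it gives `x ^ (m + 1)` times a constant,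
up to a tail that is small because the symbol decays. The rest is `r` times a new amplitude, hence
an integral of the same kind with `m + 1` in place of `m`. Each round yields one more coefficient
(`radialIntegral_step`, `uniformJet_radialIntegral`).

No smoothness in `θ` is used for the coefficients, only expansions in `r` that are uniform in `θ`
and `t`. This is `UniformJet`, which is stable under products, inverses, roots and integration over
the parameter. The existence of the root `s` with all its expansions is `exists_isRadialPhase`. The
first coefficient, after `t = σ ^ k`, is the stated product of a pairing and a sphere integral.
Finally `k` is even because `P(-v) = (-1) ^ k P(v)` and `P` has one sign. -/

/-- The family `u i` has an asymptotic expansion `b₀ i + b₁ i * r + ⋯ + O(r ^ J)` on `(0, R]`, with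
coefficients and remainder bounded uniformly in `i`. -/
def UniformJet {ι : Type*} (R : ℝ) : ℕ → (ι → ℝ → ℝ) → Prop
  | 0, u => ∃ C, ∀ i, ∀ r ∈ Ioc 0 R, |u i r| ≤ C
  | J + 1, u => ∃ (b : ι → ℝ) (v : ι → ℝ → ℝ), (∃ C, ∀ i, |b i| ≤ C) ∧ UniformJet R J v ∧
      ∀ i, ∀ r ∈ Ioc 0 R, u i r = b i + r * v i r

/-! ### Calculus of uniform asymptotic expansions at `0`. -/

namespace UniformJet

variable {ι κ : Type*} {R : ℝ} {J : ℕ} {u v : ι → ℝ → ℝ}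

theorem congr (hu : UniformJet R J u) (h : ∀ i, ∀ r ∈ Ioc 0 R, u i r = v i r) :
    UniformJet R J v := by
  cases J with
  | zero =>
    obtain ⟨C, hC⟩ := hu
    exact ⟨C, fun i r hr => h i r hr ▸ hC i r hr⟩
  | succ J =>
    obtain ⟨b, w, hb, hw, e⟩ := hu
    exact ⟨b, w, hb, hw, fun i r hr => h i r hr ▸ e i r hr⟩

theorem reindex (hu : UniformJet R J u) (e : κ → ι) : UniformJet R J (fun j => u (e j)) := by
  induction J generalizing u with
  | zero =>
    obtain ⟨C, hC⟩ := hu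
    exact ⟨C, fun i r hr => hC _ r hr⟩
  | succ J ih =>
    obtain ⟨b, w, ⟨C, hb⟩, hw, h⟩ := hu
    exact ⟨fun j => b (e j), _, ⟨C, fun j => hb _⟩, ih hw, fun i r hr => h _ r hr⟩

theorem of_succ (hu : UniformJet R (J + 1) u) : UniformJet R J u := by
  induction J generalizing u with
  | zero =>
    obtain ⟨b, w, ⟨C, hb⟩, ⟨D, hw⟩, e⟩ := hu
    refine ⟨C + R * D, fun i r hr => ?_⟩
    have hD : 0 ≤ D := (abs_nonneg _).trans (hw i r hr)
    calc |u i r| = |b i + r * w i r| := by rw [e i r hr]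
      _ ≤ |b i| + |r * w i r| := abs_add_le _ _
      _ = |b i| + r * |w i r| := by rw [abs_mul, abs_of_pos hr.1]
      _ ≤ C + R * D := by
        gcongr
        exacts [hb i, hr.1.le.trans hr.2, hr.2, hw i r hr]
  | succ J ih =>
    obtain ⟨b, w, hb, hw, e⟩ := hu
    exact ⟨b, w, hb, ih hw, e⟩

theorem of_le (hu : UniformJet R J u) {J' : ℕ} (h : J' ≤ J) : UniformJet R J' u := by
  induction h with
  | refl => exact hu
  | step _ ih => exact ih hu.of_succ

theorem bounded (hu : UniformJet R J u) : ∃ C, ∀ i, ∀ r ∈ Ioc 0 R, |u i r| ≤ C :=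
  hu.of_le (Nat.zero_le J)

theorem zero : UniformJet R J (fun (_ : ι) _ => 0) := by
  induction J with
  | zero => exact ⟨0, by simp⟩
  | succ J ih => exact ⟨fun _ => 0, _, ⟨0, by simp⟩, ih, by simp⟩

theorem const {b : ι → ℝ} (hb : ∃ C, ∀ i, |b i| ≤ C) : UniformJet R J (fun i _ => b i) := by
  cases J with
  | zero => exact ⟨hb.choose, fun i _ _ => hb.choose_spec i⟩
  | succ J => exact ⟨b, fun _ _ => 0, hb, zero, by simp⟩

theorem add (hu : UniformJet R J u) (hv : UniformJet R J v) :
    UniformJet R J (fun i r => u i r + v i r) := by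
  induction J generalizing u v with
  | zero =>
    obtain ⟨C, hC⟩ := hu
    obtain ⟨D, hD⟩ := hv
    exact ⟨C + D, fun i r hr => (abs_add_le _ _).trans (add_le_add (hC i r hr) (hD i r hr))⟩
  | succ J ih =>
    obtain ⟨b, w, ⟨C, hb⟩, hw, e⟩ := hu
    obtain ⟨b', w', ⟨C', hb'⟩, hw', e'⟩ := hv
    refine ⟨fun i => b i + b' i, _, ⟨C + C', fun i => (abs_add_le _ _).trans
      (add_le_add (hb i) (hb' i))⟩, ih hw hw', fun i r hr => ?_⟩
    simp only [e i r hr, e' i r hr]; ring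

theorem mul (hu : UniformJet R J u) (hv : UniformJet R J v) :
    UniformJet R J (fun i r => u i r * v i r) := by
  induction J generalizing u v with
  | zero =>
    obtain ⟨C, hC⟩ := hu
    obtain ⟨D, hD⟩ := hv
    refine ⟨C * D, fun i r hr => ?_⟩
    rw [abs_mul]
    exact mul_le_mul (hC i r hr) (hD i r hr) (abs_nonneg _) ((abs_nonneg _).trans (hC i r hr))
  | succ J ih =>
    -- The remainder of the product is `w * v + b * w'`: the factor `v` enters whole and is needed
    -- at order `J` only.
    have hv₀ := hv.of_succ
    obtain ⟨b, w, ⟨C, hb⟩, hw, e⟩ := hu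
    obtain ⟨b', w', ⟨C', hb'⟩, hw', e'⟩ := hv
    refine ⟨fun i => b i * b' i, _, ⟨C * C', fun i => ?_⟩,
      (ih hw hv₀).add (ih (const ⟨C, hb⟩) hw'), fun i r hr => ?_⟩
    · rw [abs_mul]
      exact mul_le_mul (hb i) (hb' i) (abs_nonneg _) ((abs_nonneg _).trans (hb i))
    · simp only [e i r hr]; rw [e' i r hr]; ring

theorem id_mul (hu : UniformJet R J u) : UniformJet R (J + 1) (fun i r => r * u i r) :=
  ⟨fun _ => 0, u, ⟨0, by simp⟩, hu, by simp⟩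

theorem pow (hu : UniformJet R J u) (m : ℕ) : UniformJet R J (fun i r => u i r ^ m) := by
  induction m with
  | zero => simpa using const (b := fun _ : ι => (1 : ℝ)) ⟨1, by simp⟩
  | succ m ih => simpa only [pow_succ] using ih.mul hu

theorem sum {α : Type*} {s : Finset α} {w : α → ι → ℝ → ℝ} (h : ∀ a ∈ s, UniformJet R J (w a)) :
    UniformJet R J (fun i r => ∑ a ∈ s, w a i r) := by
  classical
  induction s using Finset.induction_on with
  | empty => simpa using zero
  | insert a s ha ih =>
    simp only [Finset.sum_insert ha]
    exact (h a (by simp)).add (ih fun b hb => h b (by simp [hb]))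

theorem tendsto_of_eq_add_mul {b : ι → ℝ} {w : ι → ℝ → ℝ} (hw : UniformJet R 0 w)
    (h : ∀ i, ∀ r ∈ Ioc 0 R, u i r = b i + r * w i r) (i : ι) (hR : 0 < R) :
    Tendsto (u i) (𝓝[>] 0) (𝓝 (b i)) := by
  obtain ⟨C, hC⟩ := hw
  rw [tendsto_iff_norm_sub_tendsto_zero]
  have h0 : Tendsto (fun r : ℝ => C * r) (𝓝[>] 0) (𝓝 0) := by
    have : Tendsto (fun r : ℝ => C * r) (𝓝 0) (𝓝 (C * 0)) := by
      exact (continuous_const.mul continuous_id).tendsto 0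
    simpa using this.mono_left nhdsWithin_le_nhds
  refine squeeze_zero' (Eventually.of_forall fun _ => norm_nonneg _) ?_ h0
  filter_upwards [Ioc_mem_nhdsGT hR] with r hr
  rw [h i r hr, add_sub_cancel_left, Real.norm_eq_abs, abs_mul, abs_of_pos hr.1, mul_comm]
  exact mul_le_mul_of_nonneg_right (hC i r hr) hr.1.le

/-- The leading coefficient of a jet is its limit at `0`. -/
theorem sub_lim_div (hu : UniformJet R (J + 1) u) (hR : 0 < R) {l : ι → ℝ}
    (hl : ∀ i, Tendsto (u i) (𝓝[>] 0) (𝓝 (l i))) :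
    (∃ C, ∀ i, |l i| ≤ C) ∧ UniformJet R J (fun i r => (u i r - l i) / r) := by
  obtain ⟨b, w, hb, hw, e⟩ := hu
  have hbl : b = l := funext fun i =>
    tendsto_nhds_unique (tendsto_of_eq_add_mul (hw.of_le (Nat.zero_le J)) e i hR) (hl i)
  subst hbl
  refine ⟨hb, hw.congr fun i r hr => ?_⟩
  rw [e i r hr, add_sub_cancel_left, mul_div_cancel_left₀ _ hr.1.ne']

theorem exists_tendsto (hu : UniformJet R (J + 1) u) (hR : 0 < R) :
    ∃ l : ι → ℝ, ∀ i, Tendsto (u i) (𝓝[>] 0) (𝓝 (l i)) := by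
  obtain ⟨b, w, hb, hw, e⟩ := hu
  exact ⟨b, fun i => tendsto_of_eq_add_mul (hw.of_le (Nat.zero_le J)) e i hR⟩

theorem of_sub_div {l : ι → ℝ} (hl : ∃ C, ∀ i, |l i| ≤ C)
    (hu : UniformJet R J (fun i r => (u i r - l i) / r)) : UniformJet R (J + 1) u := by
  refine ⟨l, _, hl, hu, fun i r hr => ?_⟩
  rw [mul_div_cancel₀ _ hr.1.ne']; ring

theorem of_le_pow {C : ℝ} (h : ∀ i, ∀ r ∈ Ioc 0 R, |u i r| ≤ C * r ^ J) : UniformJet R J u := by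
  induction J generalizing u with
  | zero => exact ⟨C, fun i r hr => by simpa using h i r hr⟩
  | succ J ih =>
    refine of_sub_div (l := fun _ => 0) ⟨0, by simp⟩ (ih fun i r hr => ?_)
    rw [sub_zero, abs_div, abs_of_pos hr.1, div_le_iff₀ hr.1]
    calc _ ≤ _ := h i r hr
      _ = _ := by ring

/-- The bound by `C * r ^ k` makes the first `k` coefficients vanish, so one may divide by `r` a
total of `k` times, at the price of one order each time. -/
theorem div_pow {k : ℕ} (hu : UniformJet R (J + k) u) {C : ℝ}
    (h : ∀ i, ∀ r ∈ Ioc 0 R, |u i r| ≤ C * r ^ k) :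
    UniformJet R J (fun i r => u i r / r ^ k) := by
  rcases le_or_gt R 0 with hR | hR
  · refine (zero (ι := ι)).congr fun i r hr => ?_
    exact absurd (hr.1.trans_le hr.2) (not_lt.2 hR)
  induction k generalizing u with
  | zero => simpa using hu
  | succ k ih =>
    have hlim : ∀ i, Tendsto (u i) (𝓝[>] 0) (𝓝 0) := fun i => by
      refine tendsto_of_eq_add_mul (b := fun _ => 0) (w := fun i r => u i r / r) (R := R)
        ⟨C * R ^ k, fun i r hr => ?_⟩ (fun i r hr => ?_) i hR
      · rw [abs_div, abs_of_pos hr.1, div_le_iff₀ hr.1]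
        refine (h i r hr).trans ?_
        have hC : 0 ≤ C := nonneg_of_mul_nonneg_left ((abs_nonneg _).trans (h i r hr))
          (pow_pos hr.1 _)
        have := pow_le_pow_left₀ hr.1.le hr.2 k
        have hr0 := hr.1.le
        calc C * r ^ (k + 1) = C * r ^ k * r := by ring
          _ ≤ _ := by gcongr
      · rw [mul_div_cancel₀ _ hr.1.ne', zero_add]
    have h1 := (sub_lim_div (J := J + k) hu hR hlim).2
    refine (ih h1 fun i r hr => ?_).congr fun i r hr => ?_
    · rw [sub_zero, abs_div, abs_of_pos hr.1, div_le_iff₀ hr.1]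
      calc _ ≤ _ := h i r hr
        _ = _ := by ring
    · rw [sub_zero, div_div, pow_succ']

/-- Induction on the order through `1/u - 1/l = -(1/l) (1/u) (u - l)`, where `l` is the limit of
`u`: the right side needs `1/u` one order lower only. -/
theorem inv (hu : UniformJet R J u) {δ : ℝ} (hδ : 0 < δ) (h : ∀ i, ∀ r ∈ Ioc 0 R, δ ≤ u i r) :
    UniformJet R J (fun i r => (u i r)⁻¹) := by
  rcases le_or_gt R 0 with hR | hR
  · refine (zero (ι := ι)).congr fun i r hr => ?_
    exact absurd (hr.1.trans_le hr.2) (not_lt.2 hR)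
  induction J with
  | zero =>
    refine ⟨δ⁻¹, fun i r hr => ?_⟩
    rw [abs_inv, abs_of_pos (hδ.trans_le (h i r hr))]
    exact inv_anti₀ hδ (h i r hr)
  | succ J ih =>
    have h1 := ih hu.of_succ
    obtain ⟨l, hl⟩ := hu.exists_tendsto hR
    have hle : ∀ i, δ ≤ l i := fun i => ge_of_tendsto (hl i) (by
      filter_upwards [Ioc_mem_nhdsGT hR] with r hr using h i r hr)
    obtain ⟨_, h2⟩ := hu.sub_lim_div hR hl
    have hb : ∃ C, ∀ i, |(l i)⁻¹| ≤ C := ⟨δ⁻¹, fun i => by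
      rw [abs_inv, abs_of_pos (hδ.trans_le (hle i))]
      exact inv_anti₀ hδ (hle i)⟩
    refine of_sub_div hb (((const (b := fun _ => (-1 : ℝ)) ⟨1, by simp⟩).mul
      ((const hb).mul (h1.mul h2))).congr fun i r hr => ?_)
    have a1 := (hδ.trans_le (h i r hr)).ne'
    have a2 := (hδ.trans_le (hle i)).ne'
    have a3 := hr.1.ne'
    field_simp
    ring

/-- Induction on the order through `u - l = (u ^ k - l ^ k) / ∑ u ^ a l ^ (k - 1 - a)`, with `l` the
root of the limit of `u ^ k`. The denominator involves `u` one order lower, and it is at least its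
term `a = 0`, hence at least `δ ^ (k - 1)`. -/
theorem of_pow {k : ℕ} (hk : k ≠ 0) (hu : UniformJet R J (fun i r => u i r ^ k)) {δ : ℝ}
    (hδ : 0 < δ) (h : ∀ i, ∀ r ∈ Ioc 0 R, δ ≤ u i r) : UniformJet R J u := by
  rcases le_or_gt R 0 with hR | hR
  · refine (zero (ι := ι)).congr fun i r hr => ?_
    exact absurd (hr.1.trans_le hr.2) (not_lt.2 hR)
  induction J with
  | zero =>
    obtain ⟨C, hC⟩ := hu
    refine ⟨max 1 C, fun i r hr => ?_⟩
    have h0 := hδ.trans_le (h i r hr)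
    rw [abs_of_pos h0]
    rcases le_total (u i r) 1 with h1 | h1
    · exact h1.trans (le_max_left _ _)
    · exact (le_self_pow₀ h1 hk).trans (((le_abs_self _).trans (hC i r hr)).trans (le_max_right _ _))
  | succ J ih =>
    have h1 := ih hu.of_succ
    obtain ⟨L, hL⟩ := hu.exists_tendsto hR
    have hle : ∀ i, δ ^ k ≤ L i := fun i => ge_of_tendsto (hL i) (by
      filter_upwards [Ioc_mem_nhdsGT hR] with r hr using pow_le_pow_left₀ hδ.le (h i r hr) k)
    have hLpos : ∀ i, 0 < L i := fun i => (pow_pos hδ k).trans_le (hle i)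
    obtain ⟨⟨C, hC⟩, h2⟩ := hu.sub_lim_div hR hL
    have hroot : ∀ i, (L i ^ (k : ℝ)⁻¹) ^ k = L i := fun i =>
      Real.rpow_inv_natCast_pow (hLpos i).le hk
    set l : ι → ℝ := fun i => L i ^ (k : ℝ)⁻¹ with hl
    have hlpos : ∀ i, 0 < l i := fun i => Real.rpow_pos_of_pos (hLpos i) _
    have hδl : ∀ i, δ ≤ l i := fun i => by
      by_contra hcon
      have := pow_lt_pow_left₀ (not_le.1 hcon) (hlpos i).le hk
      rw [hroot i] at this
      exact absurd (hle i) (not_le.2 this)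
    have hb : ∃ C, ∀ i, |l i| ≤ C := ⟨max 1 C, fun i => by
      rw [abs_of_pos (hlpos i)]
      rcases le_total (l i) 1 with h1 | h1
      · exact h1.trans (le_max_left _ _)
      · refine (le_self_pow₀ h1 hk).trans ?_
        rw [hroot i]
        exact ((le_abs_self _).trans (hC i)).trans (le_max_right _ _)⟩
    have hden := sum (s := Finset.range k) (w := fun a i r => u i r ^ a * l i ^ (k - 1 - a))
      (fun a _ => (h1.pow a).mul ((const hb).pow _))
    have hdenpos : ∀ i, ∀ r ∈ Ioc 0 R, δ ^ (k - 1) ≤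
        ∑ a ∈ Finset.range k, u i r ^ a * l i ^ (k - 1 - a) := fun i r hr => by
      have hp := hδ.trans_le (h i r hr)
      calc δ ^ (k - 1) ≤ u i r ^ 0 * l i ^ (k - 1 - 0) := by
            simpa using pow_le_pow_left₀ hδ.le (hδl i) (k - 1)
        _ ≤ _ := Finset.single_le_sum (f := fun a => u i r ^ a * l i ^ (k - 1 - a))
            (fun a _ => mul_nonneg (pow_nonneg hp.le _) (pow_nonneg (hlpos i).le _))
            (Finset.mem_range.2 (Nat.pos_of_ne_zero hk))
    refine of_sub_div hb ((h2.mul (hden.inv (pow_pos hδ _) hdenpos)).congr fun i r hr => ?_)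
    have key := (Commute.all (u i r) (l i)).geom_sum₂_mul k
    have hd := ((pow_pos hδ _).trans_le (hdenpos i r hr)).ne'
    rw [← hroot i, ← key]
    have := hr.1.ne'
    field_simp

theorem of_sum {b : ℕ → ι → ℝ} (hb : ∀ j < J, ∃ C, ∀ i, |b j i| ≤ C) {C : ℝ}
    (h : ∀ i, ∀ r ∈ Ioc 0 R, |u i r - ∑ j ∈ Finset.range J, b j i * r ^ j| ≤ C * r ^ J) :
    UniformJet R J u := by
  have h1 : ∀ m, UniformJet R J (fun (_ : ι) r => r ^ m) := fun m => by
    induction m with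
    | zero => simpa using const (b := fun _ : ι => (1 : ℝ)) ⟨1, by simp⟩
    | succ m ih => simpa only [pow_succ'] using ih.id_mul.of_succ
  refine ((sum (s := Finset.range J) fun j hj => (const (hb j (Finset.mem_range.1 hj))).mul
    (h1 j)).add (of_le_pow h)).congr fun i r hr => ?_
  simp

/-- A function that has jets of all orders has a full asymptotic expansion. -/
theorem exists_expansion {w : ℝ → ℝ} (hR : 0 < R)
    (h : ∀ J, UniformJet R J (fun _ : Unit => w)) :
    ∃ c : ℕ → ℝ, ∀ J, ∃ C, ∀ r ∈ Ioc 0 R,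
      |w r - ∑ j ∈ Finset.range J, c j * r ^ j| ≤ C * r ^ J := by
  -- The remainder again has jets of all orders, so the step can be iterated. Fixing one choice of
  -- step makes the coefficients independent of `J`.
  have step : ∀ w : {w : ℝ → ℝ // ∀ J, UniformJet R J (fun _ : Unit => w)},
      ∃ (b : ℝ) (v : {w : ℝ → ℝ // ∀ J, UniformJet R J (fun _ : Unit => w)}),
        ∀ r ∈ Ioc 0 R, w.1 r = b + r * v.1 r := fun w => by
    obtain ⟨l, hl⟩ := (w.2 1).exists_tendsto hR
    refine ⟨l (), ⟨fun r => (w.1 r - l ()) / r, fun J => ((w.2 (J + 1)).sub_lim_div hR hl).2⟩, ?_⟩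
    intro r hr
    simp only
    rw [mul_div_cancel₀ _ hr.1.ne']
    ring
  choose B V hBV using step
  let s : ℕ → {w : ℝ → ℝ // ∀ J, UniformJet R J (fun _ : Unit => w)} :=
    fun j => V^[j] ⟨w, h⟩
  have hs : ∀ J, ∀ r ∈ Ioc 0 R,
      w r = ∑ j ∈ Finset.range J, B (s j) * r ^ j + r ^ J * (s J).1 r := fun J r hr => by
    induction J with
    | zero => simp [s]
    | succ J ih =>
      have : s (J + 1) = V (s J) := Function.iterate_succ_apply' V J _
      rw [ih, Finset.sum_range_succ, this, hBV (s J) r hr]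
      ring
  refine ⟨fun j => B (s j), fun J => ?_⟩
  obtain ⟨C, hC⟩ := ((s J).2 0).bounded
  refine ⟨C, fun r hr => ?_⟩
  rw [hs J r hr, add_sub_cancel_left, abs_mul, abs_of_pos (pow_pos hr.1 J), mul_comm]
  exact mul_le_mul_of_nonneg_right (hC () r hr) (pow_pos hr.1 J).le

end UniformJet

/-! ### Taylor expansion with uniform bounds. -/

theorem abs_sub_taylor_le {f : ℝ → ℝ} (hf : ContDiff ℝ ∞ f) {R C : ℝ} {J : ℕ} (hR : 0 < R)
    (hC : ∀ r ∈ Icc 0 R, |iteratedDeriv J f r| ≤ C) {r : ℝ} (hr : r ∈ Icc 0 R) :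
    |f r - ∑ j ∈ Finset.range J, iteratedDeriv j f 0 / (j.factorial : ℝ) * r ^ j| ≤ C * r ^ J := by
  have hu : UniqueDiffOn ℝ (Icc 0 R) := uniqueDiffOn_Icc hR
  have hit : ∀ j : ℕ, ∀ y ∈ Icc 0 R, iteratedDerivWithin j f (Icc 0 R) y = iteratedDeriv j f y :=
    fun j y hy => iteratedDerivWithin_eq_iteratedDeriv hu
      ((hf.of_le (by exact_mod_cast le_top)).contDiffAt) hy
  cases J with
  | zero => simpa using hC r hr
  | succ J =>
    have h := taylor_mean_remainder_bound (f := f) (C := C) (n := J) hR.le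
      ((hf.of_le (by exact_mod_cast le_top)).contDiffOn) hr (fun y hy => by
        rw [hit _ y hy]; exact hC y hy)
    rw [taylor_within_apply, Real.norm_eq_abs, sub_zero] at h
    have h0 : (0 : ℝ) ∈ Icc 0 R := ⟨le_rfl, hR.le⟩
    have hCr : 0 ≤ C * r ^ (J + 1) :=
      mul_nonneg ((abs_nonneg _).trans (hC 0 h0)) (pow_nonneg hr.1 _)
    refine le_trans (le_of_eq ?_) (h.trans (div_le_self hCr (by exact_mod_cast J.factorial_pos)))
    congr 2
    refine Finset.sum_congr rfl fun j _ => ?_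
    rw [hit j 0 h0, smul_eq_mul]
    field_simp

/-- Letting `r → 0` gives `a 0 = 0`; then divide by `r` and repeat. -/
theorem eq_zero_of_abs_sum_le {R C : ℝ} (hR : 0 < R) {M : ℕ} {a : ℕ → ℝ}
    (h : ∀ r ∈ Ioc 0 R, |∑ j ∈ Finset.range M, a j * r ^ j| ≤ C * r ^ M) : ∀ j < M, a j = 0 := by
  induction M generalizing a with
  | zero => simp
  | succ M ih =>
    have h0 : a 0 = 0 := by
      have t1 : Tendsto (fun r : ℝ => |∑ j ∈ Finset.range (M + 1), a j * r ^ j|) (𝓝[>] 0)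
          (𝓝 |a 0|) := by
        have : Continuous (fun r : ℝ => |∑ j ∈ Finset.range (M + 1), a j * r ^ j|) := by fun_prop
        simpa [Finset.sum_range_succ'] using (this.tendsto 0).mono_left nhdsWithin_le_nhds
      have t2 : Tendsto (fun r : ℝ => C * r ^ (M + 1)) (𝓝[>] 0) (𝓝 0) := by
        have : Continuous (fun r : ℝ => C * r ^ (M + 1)) := by fun_prop
        simpa using (this.tendsto 0).mono_left nhdsWithin_le_nhds
      have := le_of_tendsto_of_tendsto t1 t2 (by
        filter_upwards [Ioc_mem_nhdsGT hR] with r hr using h r hr)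
      exact abs_nonpos_iff.1 this
    have h1 := ih (a := fun j => a (j + 1)) fun r hr => by
      have := h r hr
      rw [Finset.sum_range_succ', h0, zero_mul, add_zero,
        Finset.sum_congr rfl fun j _ => show a (j + 1) * r ^ (j + 1) = r * (a (j + 1) * r ^ j) by
          ring, ← Finset.mul_sum, abs_mul, abs_of_pos hr.1,
        show C * r ^ (M + 1) = r * (C * r ^ M) by ring] at this
      exact le_of_mul_le_mul_left this hr.1
    intro j hj
    cases j with
    | zero => exact h0
    | succ j => exact h1 j (by omega)

section Families

variable {ι : Type*} {R : ℝ} {f : ι → ℝ → ℝ}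

theorem uniformJet_of_contDiff (hR : 0 < R) (hf : ∀ i, ContDiff ℝ ∞ (f i))
    (hb : ∀ m : ℕ, ∃ C, ∀ i, ∀ r ∈ Icc 0 R, |iteratedDeriv m (f i) r| ≤ C) (J : ℕ) :
    UniformJet R J f := by
  obtain ⟨C, hC⟩ := hb J
  refine UniformJet.of_sum (b := fun j i => iteratedDeriv j (f i) 0 / (j.factorial : ℝ))
    (fun j _ => ?_) (C := C)
    fun i r hr => abs_sub_taylor_le (hf i) hR (hC i) ⟨hr.1.le, hr.2⟩
  obtain ⟨D, hD⟩ := hb j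
  refine ⟨D, fun i => ?_⟩
  rw [abs_div, Nat.abs_cast]
  exact (div_le_self (abs_nonneg _) (by exact_mod_cast j.factorial_pos)).trans
    (hD i 0 ⟨le_rfl, hR.le⟩)

/-- A smooth function that vanishes to order `m + 1` at `0` has a derivative that vanishes to
order `m`. -/
theorem abs_deriv_le_of_abs_le (hR : 0 < R) (hf : ∀ i, ContDiff ℝ ∞ (f i))
    (hb : ∀ m : ℕ, ∃ C, ∀ i, ∀ r ∈ Icc 0 R, |iteratedDeriv m (f i) r| ≤ C) {m : ℕ} {C : ℝ}
    (h : ∀ i, ∀ r ∈ Ioc 0 R, |f i r| ≤ C * r ^ (m + 1)) :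
    ∃ D, ∀ i, ∀ r ∈ Ioc 0 R, |deriv (f i) r| ≤ D * r ^ m := by
  obtain ⟨D, hD⟩ := hb (m + 1)
  refine ⟨D, fun i r hr => ?_⟩
  -- The Taylor polynomial of degree `m` differs from `f i` by at most `D * r ^ (m + 1)`, so it is
  -- itself bounded by `(C + D) * r ^ (m + 1)` and vanishes. The Taylor coefficients of the
  -- derivative up to degree `m - 1` vanish with it.
  have hz := eq_zero_of_abs_sum_le (a := fun j => iteratedDeriv j (f i) 0 / (j.factorial : ℝ))
    (M := m + 1) (C := C + D) hR fun r hr => by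
      have h1 := abs_sub_taylor_le (hf i) hR (hD i) (Ioc_subset_Icc_self hr)
      have h2 := h i r hr
      rw [abs_le] at *
      constructor <;> linarith [h1.1, h1.2, h2.1, h2.2]
  have hd : ContDiff ℝ ∞ (deriv (f i)) := by
    have := (hf i).iterate_deriv 1
    simpa using this
  have h3 := abs_sub_taylor_le hd hR (J := m) (C := D) (fun r hr => by
    rw [← iteratedDeriv_succ']; exact hD i r hr) (Ioc_subset_Icc_self hr)
  rwa [Finset.sum_eq_zero, sub_zero] at h3
  intro j hj
  have := hz (j + 1) (by have := Finset.mem_range.1 hj; omega)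
  rw [div_eq_zero_iff, or_iff_left (by exact_mod_cast (j + 1).factorial_ne_zero)] at this
  rw [← iteratedDeriv_succ', this, zero_div, zero_mul]

end Families

/-! ### Radial integrals along a phase. -/

/-- The majorant `(1 + τ ^ 2)⁻¹` is integrable with an explicit primitive. It is reached from `1 + τ
≤ 2 (1 + τ ^ k)`; two of the `N` powers supply the decay and `m` of them absorb `τ ^ m`. -/
theorem weight_mul_pow_le {k m N : ℕ} (hk : k ≠ 0) (hN : m + 2 ≤ N) {τ : ℝ} (hτ : 0 ≤ τ) :
    ((1 + |τ ^ k|) ^ N)⁻¹ * τ ^ m ≤ 2 ^ N * (1 + τ ^ 2)⁻¹ := by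
  rw [abs_of_nonneg (pow_nonneg hτ k)]
  have h1 : 1 + τ ≤ 2 * (1 + τ ^ k) := by
    have hp := pow_nonneg hτ k
    rcases le_total τ 1 with h | h
    · linarith
    · linarith [le_self_pow₀ h hk]
  have h2 : (1 + τ) ^ N ≤ 2 ^ N * (1 + τ ^ k) ^ N := by
    rw [← mul_pow]
    exact pow_le_pow_left₀ (by linarith) h1 N
  have h3 : τ ^ m * (1 + τ ^ 2) ≤ (1 + τ) ^ N := calc
    τ ^ m * (1 + τ ^ 2) ≤ (1 + τ) ^ m * (1 + τ) ^ 2 := by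
      gcongr
      · linarith
      · nlinarith
    _ = (1 + τ) ^ (m + 2) := by ring
    _ ≤ _ := pow_le_pow_right₀ (by linarith) hN
  have hp : 0 < (1 + τ ^ k) ^ N := by have := pow_nonneg hτ k; positivity
  rw [inv_mul_le_iff₀ hp, ← mul_assoc, ← div_eq_mul_inv, le_div_iff₀ (by positivity)]
  linarith

/-- `s` is a family of increasing functions on `[0, R]`, with derivative `s'`, which behave at `0`
like multiples of `r`, and have jets of all orders there. -/
structure IsRadialPhase {ι : Type*} (R δ : ℝ) (s s' : ι → ℝ → ℝ) : Prop where
  radius_pos : 0 < R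
  slope_pos : 0 < δ
  map_zero : ∀ i, s i 0 = 0
  continuousOn : ∀ i, ContinuousOn (s i) (Icc 0 R)
  hasDerivAt : ∀ i, ∀ r ∈ Ioo 0 R, HasDerivAt (s i) (s' i r) r
  continuousOn_deriv : ∀ i, ContinuousOn (s' i) (Ioc 0 R)
  le_self : ∀ i, ∀ r ∈ Ioc 0 R, δ * r ≤ s i r
  le_deriv : ∀ i, ∀ r ∈ Ioc 0 R, δ ≤ s' i r
  jet : ∀ J, UniformJet R J (fun i r => s i r / r)
  jet_deriv : ∀ J, UniformJet R J s'

/-- The integral `x ^ (-m-1) ∫₀ᴿ (1 + |t|) ^ (-N) u(t, r) r ^ m dr`, taken along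
`t = (s(r) / x) ^ k`. -/
noncomputable def radialIntegral {ι : Type*} (R : ℝ) (s : ι → ℝ → ℝ) (k m N : ℕ)
    (u : ι → ℝ → ℝ → ℝ) (i : ι) (x : ℝ) : ℝ :=
  (x ^ (m + 1))⁻¹ *
    ∫ r in (0 : ℝ)..R, ((1 + |(s i r / x) ^ k|) ^ N)⁻¹ * u i ((s i r / x) ^ k) r * r ^ m

namespace IsRadialPhase

variable {ι : Type*} {R δ : ℝ} {s s' : ι → ℝ → ℝ} {k m N : ℕ}

/-- As `s ≥ δ r`, the decreasing weight is at most its value at `δ r / x`. In the variable `δ r / x`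
the integral scales like `x ^ (m + 1)`, which the prefactor cancels. -/
theorem radialIntegral_bounded (h : IsRadialPhase R δ s s') (hk : k ≠ 0) (hN : m + 2 ≤ N)
    {u : ι → ℝ → ℝ → ℝ} {C : ℝ} (hu : ∀ i t, ∀ r ∈ Ioc 0 R, |u i t r| ≤ C) :
    UniformJet 1 0 (radialIntegral R s k m N u) := by
  have hδ := h.slope_pos
  refine ⟨C * (δ ^ m)⁻¹ * 2 ^ N * (δ⁻¹ * (Real.pi / 2)), fun i x hx => ?_⟩
  have hx0 := hx.1
  have hC : 0 ≤ C := (abs_nonneg _).trans (hu i 0 R ⟨h.radius_pos, le_rfl⟩)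
  have hcont : Continuous fun r : ℝ => C * x ^ m * (δ ^ m)⁻¹ * 2 ^ N * (1 + (δ / x * r) ^ 2)⁻¹ := by
    refine continuous_const.mul (Continuous.inv₀ (by fun_prop) fun r => ?_)
    positivity
  have h1 := intervalIntegral.norm_integral_le_of_norm_le (μ := volume) h.radius_pos.le
    (f := fun r => ((1 + |(s i r / x) ^ k|) ^ N)⁻¹ * u i ((s i r / x) ^ k) r * r ^ m)
    (Eventually.of_forall fun r hr => ?_) (hcont.intervalIntegrable 0 R)
  · rw [radialIntegral, abs_mul, abs_inv, abs_of_pos (pow_pos hx0 _), inv_mul_le_iff₀ (by positivity)]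
    refine (Real.norm_eq_abs _ ▸ h1).trans ?_
    rw [intervalIntegral.integral_const_mul,
      intervalIntegral.integral_comp_mul_left (fun y => (1 + y ^ 2)⁻¹) (div_pos hδ hx0).ne',
      integral_inv_one_add_sq, mul_zero, Real.arctan_zero, sub_zero, smul_eq_mul, inv_div]
    have := (Real.arctan_lt_pi_div_two (δ / x * R)).le
    calc _ ≤ C * x ^ m * (δ ^ m)⁻¹ * 2 ^ N * (x / δ * (Real.pi / 2)) := by gcongr
      _ = _ := by ring
  · rw [Real.norm_eq_abs, abs_mul, abs_mul, abs_of_nonneg (pow_nonneg hr.1.le m),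
      abs_of_nonneg (by positivity : 0 ≤ ((1 + |(s i r / x) ^ k|) ^ N)⁻¹)]
    have hr0 := hr.1
    have hle : δ / x * r ≤ s i r / x := by
      rw [div_mul_eq_mul_div]
      exact div_le_div_of_nonneg_right (h.le_self i r hr) hx0.le
    have h0 : 0 ≤ δ / x * r := by positivity
    have hw : ((1 + |(s i r / x) ^ k|) ^ N)⁻¹ ≤ ((1 + |(δ / x * r) ^ k|) ^ N)⁻¹ := by
      rw [abs_of_nonneg (pow_nonneg h0 _), abs_of_nonneg (pow_nonneg (h0.trans hle) _)]
      gcongr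
    calc _ ≤ ((1 + |(δ / x * r) ^ k|) ^ N)⁻¹ * C * r ^ m := by
          gcongr
          exact hu i _ r hr
      _ = C * x ^ m * (δ ^ m)⁻¹ * (((1 + |(δ / x * r) ^ k|) ^ N)⁻¹ * (δ / x * r) ^ m) := by
          rw [mul_pow (δ / x) r m, div_pow δ x m]
          generalize ((1 + |(δ / x * r) ^ k|) ^ N)⁻¹ = A
          field_simp
      _ ≤ C * x ^ m * (δ ^ m)⁻¹ * (2 ^ N * (1 + (δ / x * r) ^ 2)⁻¹) := by
          exact mul_le_mul_of_nonneg_left (weight_mul_pow_le hk hN h0) (by positivity)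
      _ = _ := by ring

theorem abs_weight_le (hk : k ≠ 0) (hN : m + 2 ≤ N) {b : ℝ → ℝ} {C : ℝ} (hC : ∀ t, |b t| ≤ C)
    {σ : ℝ} (hσ : 0 ≤ σ) :
    |((1 + |σ ^ k|) ^ N)⁻¹ * b (σ ^ k) * σ ^ m| ≤ C * 2 ^ N * (1 + σ ^ 2)⁻¹ := by
  have hC0 : 0 ≤ C := (abs_nonneg _).trans (hC 0)
  rw [abs_mul, abs_mul, abs_of_nonneg (pow_nonneg hσ m),
      abs_of_nonneg (by positivity : 0 ≤ ((1 + |σ ^ k|) ^ N)⁻¹)]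
  calc _ ≤ ((1 + |σ ^ k|) ^ N)⁻¹ * C * σ ^ m := by gcongr; exact hC _
    _ = C * (((1 + |σ ^ k|) ^ N)⁻¹ * σ ^ m) := by ring
    _ ≤ C * (2 ^ N * (1 + σ ^ 2)⁻¹) := 
          mul_le_mul_of_nonneg_left (weight_mul_pow_le hk hN hσ) hC0
    _ = _ := by ring

theorem continuous_weight {b : ℝ → ℝ} (hb : Continuous b) :
    Continuous fun σ : ℝ => ((1 + |σ ^ k|) ^ N)⁻¹ * b (σ ^ k) * σ ^ m := by
  refine ((Continuous.inv₀ (by fun_prop) fun σ => ?_).mul (by fun_prop)).mul (by fun_prop)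
  positivity

theorem integrableOn_weight (hk : k ≠ 0) (hN : m + 2 ≤ N) {b : ℝ → ℝ} (hb : Continuous b) {C : ℝ}
    (hC : ∀ t, |b t| ≤ C) :
    IntegrableOn (fun σ : ℝ => ((1 + |σ ^ k|) ^ N)⁻¹ * b (σ ^ k) * σ ^ m) (Ioi 0) := by
  refine Integrable.mono' ((integrable_inv_one_add_sq.const_mul (C * 2 ^ N)).integrableOn)
    (continuous_weight hb).aestronglyMeasurable ?_
  filter_upwards [ae_restrict_mem measurableSet_Ioi] with σ hσ
  exact abs_weight_le hk hN hC (le_of_lt hσ)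

theorem abs_integral_weight_le (hk : k ≠ 0) (hN : m + 2 ≤ N) {b : ℝ → ℝ} {C : ℝ}
    (hC : ∀ t, |b t| ≤ C) {T : ℝ} (hT : 0 ≤ T) :
    |∫ σ in Ioi T, ((1 + |σ ^ k|) ^ N)⁻¹ * b (σ ^ k) * σ ^ m| ≤ C * 2 ^ N * Real.pi := by
  have hC0 : 0 ≤ C := (abs_nonneg _).trans (hC 0)
  have hi := integrable_inv_one_add_sq.const_mul (C * 2 ^ N)
  calc _ ≤ ∫ σ in Ioi T, C * 2 ^ N * (1 + σ ^ 2)⁻¹ := by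
        rw [← Real.norm_eq_abs]
        refine norm_integral_le_of_norm_le hi.integrableOn ?_
        filter_upwards [ae_restrict_mem measurableSet_Ioi] with σ hσ
        exact abs_weight_le hk hN hC (hT.trans (le_of_lt hσ))
    _ ≤ ∫ σ : ℝ, C * 2 ^ N * (1 + σ ^ 2)⁻¹ :=
        setIntegral_le_integral hi (Eventually.of_forall fun σ => by positivity)
    _ = _ := by rw [integral_const_mul, integral_univ_inv_one_add_sq]

/-- For `σ > T` one has `σ ^ m ≤ σ ^ (m + L) / T ^ L`, and the weight can still absorb `σ ^ (m +
L)`. -/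
theorem abs_integral_tail_le (hk : k ≠ 0) {L : ℕ} (hN : m + L + 2 ≤ N) {b : ℝ → ℝ}
    {C : ℝ} (hC : ∀ t, |b t| ≤ C) {T : ℝ} (hT : 0 < T) :
    |∫ σ in Ioi T, ((1 + |σ ^ k|) ^ N)⁻¹ * b (σ ^ k) * σ ^ m| ≤
      C * 2 ^ N * Real.pi * (T ^ L)⁻¹ := by
  have hC0 : 0 ≤ C := (abs_nonneg _).trans (hC 0)
  have hi := integrable_inv_one_add_sq.const_mul (C * 2 ^ N * (T ^ L)⁻¹)
  calc _ ≤ ∫ σ in Ioi T, C * 2 ^ N * (T ^ L)⁻¹ * (1 + σ ^ 2)⁻¹ := by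
        rw [← Real.norm_eq_abs]
        refine norm_integral_le_of_norm_le hi.integrableOn ?_
        filter_upwards [ae_restrict_mem measurableSet_Ioi] with σ hσ
        have hσ' : T ≤ σ := le_of_lt hσ
        have hσ0 : 0 ≤ σ := hT.le.trans hσ'
        have h1 := abs_weight_le (m := m + L) hk hN hC hσ0
        rw [pow_add, ← mul_assoc, abs_mul _ (σ ^ L), abs_of_nonneg (pow_nonneg hσ0 L)] at h1
        rw [Real.norm_eq_abs, mul_right_comm _ (T ^ L)⁻¹, ← div_eq_mul_inv _ (T ^ L),
          le_div_iff₀ (by positivity)]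
        refine le_trans ?_ h1
        gcongr
    _ ≤ ∫ σ : ℝ, C * 2 ^ N * (T ^ L)⁻¹ * (1 + σ ^ 2)⁻¹ :=
        setIntegral_le_integral hi (Eventually.of_forall fun σ => by positivity)
    _ = _ := by rw [integral_const_mul, integral_univ_inv_one_add_sq]; ring

theorem jet_density (h : IsRadialPhase R δ s s') (m J : ℕ) :
    UniformJet R J (fun i r => (s i r / r) ^ m * s' i r) :=
  ((h.jet J).pow m).mul (h.jet_deriv J)

theorem le_density (h : IsRadialPhase R δ s s') (i : ι) {r : ℝ} (hr : r ∈ Ioc 0 R) :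
    δ ^ (m + 1) ≤ (s i r / r) ^ m * s' i r := by
  have hδ := h.slope_pos
  have h1 : δ ≤ s i r / r := (le_div_iff₀ hr.1).2 (h.le_self i r hr)
  rw [pow_succ]
  exact mul_le_mul (pow_le_pow_left₀ hδ.le h1 m) (h.le_deriv i r hr) hδ.le
    (pow_nonneg (hδ.le.trans h1) m)

theorem continuousOn_density (h : IsRadialPhase R δ s s') (m : ℕ) (i : ι) :
    ContinuousOn (fun r => (s i r / r) ^ m * s' i r) (Ioc 0 R) :=
  ((((h.continuousOn i).mono Ioc_subset_Icc_self).div continuousOn_id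
    fun _ hr => hr.1.ne').pow m).mul (h.continuousOn_deriv i)

/-- Since `r ^ m` times the density is `s ^ m s'`, the substitution `σ = s / x` is exact. The only
error is the tail beyond `s(R) / x ≥ δ R / x`. -/
theorem radialIntegral_density_sub_le (h : IsRadialPhase R δ s s') (hk : k ≠ 0) {L : ℕ}
    (hN : m + L + 2 ≤ N) {b : ι → ℝ → ℝ} (hb : ∀ i, Continuous (b i)) {C : ℝ}
    (hC : ∀ i t, |b i t| ≤ C) (i : ι) {x : ℝ} (hx : 0 < x) :
    |radialIntegral R s k m N (fun i t r => b i t * ((s i r / r) ^ m * s' i r)) i x -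
      ∫ σ in Ioi (0 : ℝ), ((1 + |σ ^ k|) ^ N)⁻¹ * b i (σ ^ k) * σ ^ m| ≤
    C * 2 ^ N * Real.pi * ((δ * R) ^ L)⁻¹ * x ^ L := by
  have hR := h.radius_pos
  have hC0 : 0 ≤ C := (abs_nonneg _).trans (hC i 0)
  set g : ℝ → ℝ := fun σ => ((1 + |σ ^ k|) ^ N)⁻¹ * b i (σ ^ k) * σ ^ m with hg
  have hgc : Continuous g := continuous_weight (hb i)
  have e1 : radialIntegral R s k m N (fun i t r => b i t * ((s i r / r) ^ m * s' i r)) i x =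
      ∫ r in (0 : ℝ)..R, ((fun y => x⁻¹ * g (y / x)) ∘ s i) r * s' i r := by
    rw [radialIntegral, ← intervalIntegral.integral_const_mul,
      intervalIntegral.integral_of_le hR.le, intervalIntegral.integral_of_le hR.le]
    refine setIntegral_congr_fun measurableSet_Ioc fun r hr => ?_
    have hr0 := hr.1.ne'
    simp only [hg, Function.comp, div_pow]
    field_simp
    ring
  have e2 := intervalIntegral.integral_comp_mul_deriv_of_deriv_nonneg (a := 0) (b := R)
    (f := s i) (f' := s' i) (g := fun y => x⁻¹ * g (y / x))
    (by rw [uIcc_of_le hR.le]; exact h.continuousOn i)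
    (by rw [min_eq_left hR.le, max_eq_right hR.le]; exact h.hasDerivAt i)
    (by
      rw [min_eq_left hR.le, max_eq_right hR.le]
      exact fun r hr => h.slope_pos.le.trans (h.le_deriv i r (Ioo_subset_Ioc_self hr)))
  have e3 : (∫ y in (s i 0)..(s i R), x⁻¹ * g (y / x)) = ∫ σ in (0 : ℝ)..(s i R / x), g σ := by
    rw [intervalIntegral.integral_const_mul, intervalIntegral.integral_comp_div g hx.ne',
      h.map_zero, zero_div, smul_eq_mul, inv_mul_cancel_left₀ hx.ne']
  have hsR : δ * R ≤ s i R := h.le_self i R ⟨hR, le_rfl⟩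
  have hδR : 0 < δ * R := mul_pos h.slope_pos hR
  have hT : 0 < s i R / x := div_pos (hδR.trans_le hsR) hx
  have hint := integrableOn_weight (m := m) hk (by omega : m + 2 ≤ N) (hb i) (hC i)
  have e4 := intervalIntegral.integral_interval_add_Ioi (a := 0) (b := s i R / x) (f := g) hint
    (hint.mono_set (Ioi_subset_Ioi hT.le))
  rw [e1, e2, e3, ← e4, sub_add_cancel_left, abs_neg]
  refine (abs_integral_tail_le hk hN (hC i) hT).trans ?_
  rw [mul_assoc _ _ (x ^ L)]
  refine mul_le_mul_of_nonneg_left ?_ (by positivity)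
  rw [← inv_pow, ← inv_pow, ← mul_pow, inv_div, ← div_eq_inv_mul]
  have := hδR.trans_le hsR
  gcongr

theorem intervalIntegrable_radial (h : IsRadialPhase R δ s s') {u : ι → ℝ → ℝ → ℝ} {C : ℝ} (i : ι)
    (hC : ∀ t, ∀ r ∈ Ioc 0 R, |u i t r| ≤ C)
    (hu : ContinuousOn (fun q : ℝ × ℝ => u i q.1 q.2) (univ ×ˢ Ioc 0 R)) (k m N : ℕ) (x : ℝ) :
    IntervalIntegrable (fun r => ((1 + |(s i r / x) ^ k|) ^ N)⁻¹ * u i ((s i r / x) ^ k) r * r ^ m)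
      volume 0 R := by
  have hR := h.radius_pos
  rw [intervalIntegrable_iff_integrableOn_Ioc_of_le hR.le]
  have hs : ContinuousOn (fun r => (s i r / x) ^ k) (Ioc 0 R) :=
    (((h.continuousOn i).mono Ioc_subset_Icc_self).div_const x).pow k
  have hcont : ContinuousOn (fun r => ((1 + |(s i r / x) ^ k|) ^ N)⁻¹ *
      u i ((s i r / x) ^ k) r * r ^ m) (Ioc 0 R) := by
    refine (ContinuousOn.mul (ContinuousOn.inv₀ ?_ fun r _ => by positivity) ?_).mul (by fun_prop)
    · exact (continuousOn_const.add hs.abs).pow N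
    · exact hu.comp (hs.prodMk continuousOn_id) fun r hr => ⟨mem_univ _, hr⟩
  refine Integrable.mono' (g := fun _ => C * R ^ m) (integrable_const _)
    (hcont.aestronglyMeasurable measurableSet_Ioc) ?_
  filter_upwards [ae_restrict_mem measurableSet_Ioc] with r hr
  have hr0 := hr.1.le
  have h1 : ((1 + |(s i r / x) ^ k|) ^ N)⁻¹ ≤ 1 :=
    inv_le_one_of_one_le₀ (one_le_pow₀ (by linarith [abs_nonneg ((s i r / x) ^ k)]))
  rw [Real.norm_eq_abs, abs_mul, abs_mul, abs_of_nonneg (pow_nonneg hr0 m),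
      abs_of_nonneg (by positivity : 0 ≤ ((1 + |(s i r / x) ^ k|) ^ N)⁻¹)]
  have hC0 : 0 ≤ C := (abs_nonneg _).trans (hC 0 r hr)
  calc _ ≤ 1 * C * R ^ m := by
        gcongr
        · exact hC _ r hr
        · exact hr.2
    _ = _ := by ring

/-- The factor `r` extracted from `u - v` raises `m` by one; the factor `x` compensates for the
higher power in the normalization. -/
theorem radialIntegral_split (h : IsRadialPhase R δ s s') {u v : ι → ℝ → ℝ → ℝ} {C D : ℝ} (i : ι)
    (hC : ∀ t, ∀ r ∈ Ioc 0 R, |u i t r| ≤ C)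
    (hu : ContinuousOn (fun q : ℝ × ℝ => u i q.1 q.2) (univ ×ˢ Ioc 0 R))
    (hD : ∀ t, ∀ r ∈ Ioc 0 R, |v i t r| ≤ D)
    (hv : ContinuousOn (fun q : ℝ × ℝ => v i q.1 q.2) (univ ×ˢ Ioc 0 R)) {x : ℝ} (hx : 0 < x) :
    radialIntegral R s k m N u i x = radialIntegral R s k m N v i x +
      x * radialIntegral R s k (m + 1) N (fun i t r => (u i t r - v i t r) / r) i x := by
  have hR := h.radius_pos
  have e : (∫ r in (0 : ℝ)..R, ((1 + |(s i r / x) ^ k|) ^ N)⁻¹ *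
      ((u i ((s i r / x) ^ k) r - v i ((s i r / x) ^ k) r) / r) * r ^ (m + 1)) =
      ∫ r in (0 : ℝ)..R, (((1 + |(s i r / x) ^ k|) ^ N)⁻¹ * u i ((s i r / x) ^ k) r * r ^ m -
        ((1 + |(s i r / x) ^ k|) ^ N)⁻¹ * v i ((s i r / x) ^ k) r * r ^ m) := by
    rw [intervalIntegral.integral_of_le hR.le, intervalIntegral.integral_of_le hR.le]
    refine setIntegral_congr_fun measurableSet_Ioc fun r hr => ?_
    have := hr.1.ne'
    generalize ((1 + |(s i r / x) ^ k|) ^ N)⁻¹ = A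
    field_simp
    ring
  rw [intervalIntegral.integral_sub (h.intervalIntegrable_radial i hC hu k m N x)
    (h.intervalIntegrable_radial i hD hv k m N x)] at e
  simp only [radialIntegral, e]
  rw [pow_succ x (m + 1)]
  field_simp
  ring

/-- The bound says that `u i t r` tends to `l i t` at rate `C * r`, uniformly in `t`, so continuity
in `t` passes to the limit. -/
theorem continuous_lim (hR : 0 < R) {u : ι → ℝ → ℝ → ℝ} {l : ι → ℝ → ℝ} {C : ℝ} {i : ι}
    (hC : ∀ t, ∀ r ∈ Ioc 0 R, |(u i t r - l i t) / r| ≤ C)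
    (hu : ContinuousOn (fun q : ℝ × ℝ => u i q.1 q.2) (univ ×ˢ Ioc 0 R)) : Continuous (l i) := by
  have hunif : TendstoUniformly (fun r t => u i t r) (l i) (𝓝[>] (0 : ℝ)) := by
    rw [Metric.tendstoUniformly_iff]
    intro ε hε
    have h0 : Tendsto (fun r : ℝ => C * r) (𝓝[>] 0) (𝓝 0) := by
      have : Continuous (fun r : ℝ => C * r) := by fun_prop
      simpa using (this.tendsto 0).mono_left nhdsWithin_le_nhds
    filter_upwards [h0.eventually (gt_mem_nhds hε), Ioc_mem_nhdsGT hR] with r h1 hr t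
    have := hC t r hr
    rw [abs_div, abs_of_pos hr.1, div_le_iff₀ hr.1] at this
    rw [dist_comm, Real.dist_eq]
    exact this.trans_lt h1
  refine hunif.continuous (Eventually.frequently ?_)
  filter_upwards [Ioc_mem_nhdsGT hR] with r hr
  rw [← continuousOn_univ]
  exact hu.comp (f := fun t : ℝ => (t, r)) (by fun_prop) fun t _ => ⟨mem_univ _, hr⟩

/-- One step of the expansion of `radialIntegral`: its leading term is the integral of the limit
`l` of `u` divided by the density. -/
theorem radialIntegral_step (h : IsRadialPhase R δ s s') (hk : k ≠ 0) {J : ℕ}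
    (hN : m + (J + 1) + 2 ≤ N) {u : ι → ℝ → ℝ → ℝ}
    (hu : UniformJet R (J + 1) (fun (q : ι × ℝ) r => u q.1 q.2 r))
    (huc : ∀ i, ContinuousOn (fun q : ℝ × ℝ => u i q.1 q.2) (univ ×ˢ Ioc 0 R))
    (ih : ∀ {v : ι → ℝ → ℝ → ℝ}, UniformJet R J (fun (q : ι × ℝ) r => v q.1 q.2 r) →
      (∀ i, ContinuousOn (fun q : ℝ × ℝ => v i q.1 q.2) (univ ×ˢ Ioc 0 R)) →
      UniformJet 1 J (radialIntegral R s k (m + 1) N v))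
    {l : ι → ℝ → ℝ}
    (hl : ∀ i t, Tendsto (fun r => u i t r / ((s i r / r) ^ m * s' i r)) (𝓝[>] 0) (𝓝 (l i t))) :
    (∃ C, ∀ i, |∫ σ in Ioi (0 : ℝ), ((1 + |σ ^ k|) ^ N)⁻¹ * l i (σ ^ k) * σ ^ m| ≤ C) ∧
    UniformJet 1 J (fun i x => (radialIntegral R s k m N u i x -
      ∫ σ in Ioi (0 : ℝ), ((1 + |σ ^ k|) ^ N)⁻¹ * l i (σ ^ k) * σ ^ m) / x) := by
  have hR := h.radius_pos
  set W : ι → ℝ → ℝ := fun i r => (s i r / r) ^ m * s' i r with hW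
  have hWpos : ∀ i, ∀ r ∈ Ioc 0 R, 0 < W i r := fun i r hr =>
    (pow_pos h.slope_pos _).trans_le (h.le_density i hr)
  have hWjet : ∀ J, UniformJet R J (fun (q : ι × ℝ) r => W q.1 r) := fun J =>
    (h.jet_density m J).reindex Prod.fst
  have hWinv := (hWjet (J + 1)).inv (pow_pos h.slope_pos (m + 1)) fun q r hr => h.le_density q.1 hr
  have hq : UniformJet R (J + 1) (fun (q : ι × ℝ) r => u q.1 q.2 r / W q.1 r) :=
    (hu.mul hWinv).congr fun q r _ => (div_eq_mul_inv _ _).symm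
  obtain ⟨⟨C, hC⟩, hjet⟩ := hq.sub_lim_div hR (l := fun q => l q.1 q.2) fun q => hl q.1 q.2
  obtain ⟨D, hD⟩ := hjet.bounded
  obtain ⟨U, hU⟩ := hu.bounded
  obtain ⟨B, hB⟩ := (hWjet 0).bounded
  have hWc := fun i => h.continuousOn_density m i
  have hWc' : ∀ i, ContinuousOn (fun q : ℝ × ℝ => W i q.2) (univ ×ˢ Ioc 0 R) := fun i =>
    (hWc i).comp continuousOn_snd fun q hq => hq.2
  have hlc : ∀ i, Continuous (l i) := fun i =>
    continuous_lim hR (u := fun i t r => u i t r / W i r) (fun t r hr => hD (i, t) r hr)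
      ((huc i).div (hWc' i) fun q hq => (hWpos i q.2 hq.2).ne')
  have hlW : ∀ i, ContinuousOn (fun q : ℝ × ℝ => l i q.1 * W i q.2) (univ ×ˢ Ioc 0 R) := fun i =>
    ((hlc i).comp continuous_fst).continuousOn.mul (hWc' i)
  -- The new amplitude is `W` times `(u / W - l) / r`, and the latter has jets one order lower.
  have hv : UniformJet R J (fun (q : ι × ℝ) r => (u q.1 q.2 r - l q.1 q.2 * W q.1 r) / r) := by
    refine (hjet.mul (hWjet J)).congr fun q r hr => ?_
    have := (hWpos q.1 r hr).ne'
    field_simp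
  have hvc : ∀ i, ContinuousOn (fun q : ℝ × ℝ => (u i q.1 q.2 - l i q.1 * W i q.2) / q.2)
      (univ ×ˢ Ioc 0 R) := fun i =>
    ((huc i).sub (hlW i)).div continuousOn_snd fun q hq => hq.2.1.ne'
  refine ⟨⟨C * 2 ^ N * Real.pi, fun i => abs_integral_weight_le hk (by omega)
    (fun t => hC (i, t)) le_rfl⟩, ?_⟩
  -- The tail is taken of order `x ^ (J + 1)`, since one power is lost in the division by `x`.
  have herr := UniformJet.of_le_pow (R := 1) (J := J) (u := fun i x =>
    (radialIntegral R s k m N (fun i t r => l i t * W i r) i x -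
      ∫ σ in Ioi (0 : ℝ), ((1 + |σ ^ k|) ^ N)⁻¹ * l i (σ ^ k) * σ ^ m) / x)
    (C := C * 2 ^ N * Real.pi * ((δ * R) ^ (J + 1))⁻¹) fun i x hx => by
      rw [abs_div, abs_of_pos hx.1, div_le_iff₀ hx.1, mul_assoc _ _ x, ← pow_succ]
      exact h.radialIntegral_density_sub_le hk hN hlc (fun i t => hC (i, t)) i hx.1
  refine (herr.add (ih (v := fun i t r => (u i t r - l i t * W i r) / r) hv hvc)).congr fun i x hx => ?_
  rw [h.radialIntegral_split (v := fun i t r => l i t * W i r) (D := C * B) i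
    (fun t r hr => hU (i, t) r hr) (huc i) (fun t r hr => ?_) (hlW i) hx.1]
  · have := hx.1.ne'
    field_simp
    ring
  · rw [abs_mul]
    exact mul_le_mul (hC (i, t)) (hB (i, 0) r hr) (abs_nonneg _) ((abs_nonneg _).trans (hC (i, t)))

/-- Each step lowers `J` and raises `m` by one, so `m + J` is constant and a single decay exponent
`N` serves the whole induction. -/
theorem uniformJet_radialIntegral (h : IsRadialPhase R δ s s') (hk : k ≠ 0) {J : ℕ}
    (hN : m + J + 2 ≤ N) {u : ι → ℝ → ℝ → ℝ}
    (hu : UniformJet R J (fun (q : ι × ℝ) r => u q.1 q.2 r))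
    (huc : ∀ i, ContinuousOn (fun q : ℝ × ℝ => u i q.1 q.2) (univ ×ˢ Ioc 0 R)) :
    UniformJet 1 J (radialIntegral R s k m N u) := by
  induction J generalizing m u with
  | zero =>
    obtain ⟨C, hC⟩ := hu
    exact h.radialIntegral_bounded hk (by omega) fun i t r hr => hC (i, t) r hr
  | succ J ih =>
    have hWinv := ((h.jet_density m (J + 1)).reindex (Prod.fst (α := ι) (β := ℝ))).inv
      (pow_pos h.slope_pos (m + 1)) fun q r hr => h.le_density q.1 hr
    obtain ⟨l, hl⟩ := (hu.mul hWinv).exists_tendsto h.radius_pos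
    obtain ⟨hb, hjet⟩ := h.radialIntegral_step hk hN hu huc (fun hv hvc => ih (by omega) hv hvc)
      (l := fun i t => l (i, t)) fun i t => by simpa only [div_eq_mul_inv] using hl (i, t)
    exact UniformJet.of_sub_div hb hjet

end IsRadialPhase

/-! ### The phase along rays and its `k`-th root. -/

section Rays

variable {E : Type*} [NormedAddCommGroup E] [NormedSpace ℝ E]

theorem abs_iteratedDeriv_ray_le {f : E → ℝ} (hf : ContDiff ℝ ∞ f) (θ : Metric.sphere (0 : E) 1)
    (m : ℕ) (r : ℝ) :
    |iteratedDeriv m (fun r : ℝ => f (r • (θ : E))) r| ≤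
      ‖iteratedFDeriv ℝ m f (r • (θ : E))‖ := by
  have h := (ContinuousLinearMap.toSpanSingleton ℝ (θ : E)).iteratedFDeriv_comp_right hf r
    (i := m) (by exact_mod_cast le_top)
  rw [← Real.norm_eq_abs, ← norm_iteratedFDeriv_eq_norm_iteratedDeriv]
  change ‖iteratedFDeriv ℝ m (f ∘ ContinuousLinearMap.toSpanSingleton ℝ (θ : E)) r‖ ≤ _
  rw [h]
  refine (ContinuousMultilinearMap.norm_compContinuousLinearMap_le _ _).trans ?_
  simp

theorem contDiff_ray {f : E → ℝ} (hf : ContDiff ℝ ∞ f) (θ : Metric.sphere (0 : E) 1) :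
    ContDiff ℝ ∞ (fun r : ℝ => f (r • (θ : E))) :=
  hf.comp (contDiff_id.smul contDiff_const)

theorem exists_abs_iteratedDeriv_ray_le [FiniteDimensional ℝ E] {f : E → ℝ} (hf : ContDiff ℝ ∞ f)
    (R : ℝ) (m : ℕ) : ∃ C, ∀ θ : Metric.sphere (0 : E) 1, ∀ r ∈ Icc 0 R,
      |iteratedDeriv m (fun r : ℝ => f (r • (θ : E))) r| ≤ C := by
  have hc : Continuous (iteratedFDeriv ℝ m f) :=
    hf.continuous_iteratedFDeriv (by exact_mod_cast le_top)
  have : ProperSpace E := FiniteDimensional.proper ℝ E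
  obtain ⟨C, hC⟩ := (isCompact_closedBall (0 : E) R).exists_bound_of_continuousOn hc.continuousOn
  refine ⟨C, fun θ r hr => (abs_iteratedDeriv_ray_le hf θ m r).trans (hC _ ?_)⟩
  simpa [norm_smul, abs_of_nonneg hr.1] using hr.2

/-- A smooth function with a positive definite homogeneous leading part of degree `k` has a `k`-th
root along rays, and this root is a radial phase. -/
theorem exists_isRadialPhase [FiniteDimensional ℝ E] [Nontrivial E] {k : ℕ} (hk : k ≠ 0)
    {F P : E → ℝ} (hF : ContDiff ℝ ∞ F) (hP : ContDiff ℝ ∞ P)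
    (hhom : ∀ (r : ℝ) v, P (r • v) = r ^ k * P v) (hpos : ∀ v, v ≠ 0 → 0 < P v)
    (hFP : (fun y => F y - P y) =O[𝓝 0] fun y => ‖y‖ ^ (k + 1)) {R₀ : ℝ} (hR₀ : 0 < R₀) :
    ∃ (R δ : ℝ) (s s' : Metric.sphere (0 : E) 1 → ℝ → ℝ), R ≤ R₀ ∧ IsRadialPhase R δ s s' ∧
      (∀ θ, ∀ r ∈ Icc 0 R, s θ r ^ k = F (r • (θ : E))) ∧
      ∀ m θ, Tendsto (fun r => (s θ r / r) ^ m * s' θ r) (𝓝[>] 0)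
        (𝓝 ((P θ ^ (k : ℝ)⁻¹) ^ (m + 1))) := by
  have hθ0 : ∀ θ : Metric.sphere (0 : E) 1, (θ : E) ≠ 0 := fun θ =>
    ne_zero_of_mem_unit_sphere θ
  have hne : Nonempty (Metric.sphere (0 : E) 1) :=
    (NormedSpace.sphere_nonempty.2 zero_le_one).to_subtype
  have hPc : Continuous fun θ : Metric.sphere (0 : E) 1 => P θ :=
    hP.continuous.comp continuous_subtype_val
  have : ProperSpace E := FiniteDimensional.proper ℝ E
  obtain ⟨θ₀, -, hmin⟩ := isCompact_univ.exists_isMinOn univ_nonempty hPc.continuousOn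
  obtain ⟨θ₁, -, hmax⟩ := isCompact_univ.exists_isMaxOn univ_nonempty hPc.continuousOn
  have hθ₀ : ∀ θ : Metric.sphere (0 : E) 1, P θ₀ ≤ P θ := fun θ => hmin (mem_univ θ)
  have hθ₁ : ∀ θ : Metric.sphere (0 : E) 1, P θ ≤ P θ₁ := fun θ => hmax (mem_univ θ)
  set a := P θ₀ / 2 with ha
  have ha0 : 0 < a := half_pos (hpos _ (hθ0 θ₀))
  set e : E → ℝ := fun y => F y - P y with he
  have hec : ContDiff ℝ ∞ e := hF.sub hP
  obtain ⟨C, hC⟩ := hFP.bound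
  obtain ⟨ε, hε, hball⟩ := Metric.eventually_nhds_iff_ball.1 hC
  set R₁ := min R₀ (ε / 2) with hR₁
  have hR₁0 : 0 < R₁ := lt_min hR₀ (half_pos hε)
  have he1 : ∀ θ : Metric.sphere (0 : E) 1, ∀ r ∈ Ioc 0 R₁, |e (r • (θ : E))| ≤ C * r ^ (k + 1) := by
    intro θ r hr
    have hn : ‖r • (θ : E)‖ = r := by simp [norm_smul, abs_of_pos hr.1]
    have := hball (r • (θ : E)) (by
      rw [mem_ball_zero_iff, hn]
      linarith [hr.2, min_le_right R₀ (ε / 2)])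
    rwa [hn, Real.norm_eq_abs, Real.norm_eq_abs, abs_of_pos (pow_pos hr.1 _)] at this
  obtain ⟨D, hD⟩ := abs_deriv_le_of_abs_le hR₁0 (contDiff_ray hec)
    (exists_abs_iteratedDeriv_ray_le hec R₁) he1
  -- One constant controls the error `e` and its radial derivative; the `1` keeps it positive. With
  -- `R ≤ a / B` the relative error is at most `a`, half the minimum of `P` on the sphere, so `F / r
  -- ^ k ≥ a`.
  set B := max 1 (max C D) with hB
  have hB0 : 0 < B := lt_max_of_lt_left one_pos
  set R := min R₁ (a / B) with hR
  have hR0 : 0 < R := lt_min hR₁0 (div_pos ha0 hB0)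
  have hRR₁ : ∀ {r}, r ∈ Ioc 0 R → r ∈ Ioc 0 R₁ := fun hr => ⟨hr.1, hr.2.trans (min_le_left _ _)⟩
  have hBr : ∀ r ∈ Ioc 0 R, B * r ≤ a := fun r hr => by
    have := hr.2.trans (min_le_right _ _)
    rwa [le_div_iff₀ hB0, mul_comm] at this
  -- the phase and its derivative along rays
  set f : Metric.sphere (0 : E) 1 → ℝ → ℝ := fun θ r => F (r • (θ : E)) with hf
  have hfc : ∀ θ, ContDiff ℝ ∞ (f θ) := contDiff_ray hF
  have hf1 : ∀ θ r, f θ r = e (r • (θ : E)) + r ^ k * P θ := fun θ r => by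
    simp only [hf, he, hhom]; ring
  have hf2 : ∀ θ r, deriv (f θ) r =
      deriv (fun r : ℝ => e (r • (θ : E))) r + k * r ^ (k - 1) * P θ := fun θ r => by
    rw [show f θ = fun r => e (r • (θ : E)) + r ^ k * P θ from funext (hf1 θ)]
    rw [deriv_fun_add (((contDiff_ray hec θ).differentiable (by simp)) r) (by fun_prop),
      deriv_mul_const (by fun_prop), deriv_pow_field]
  have hk1 : 1 ≤ (k : ℝ) := by exact_mod_cast Nat.one_le_iff_ne_zero.2 hk
  have hkp : ∀ r : ℝ, r ^ k = r ^ (k - 1) * r := fun r => by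
    rw [← pow_succ, Nat.sub_add_cancel (Nat.one_le_iff_ne_zero.2 hk)]
  have hq : ∀ θ, ∀ r ∈ Ioc 0 R, |f θ r / r ^ k - P θ| ≤ B * r := fun θ r hr => by
    have hrk := pow_pos hr.1 k
    have : f θ r / r ^ k - P θ = e (r • (θ : E)) / r ^ k := by rw [hf1]; field_simp; ring
    rw [this, abs_div, abs_of_pos hrk, div_le_iff₀ hrk]
    calc _ ≤ C * r ^ (k + 1) := he1 θ r (hRR₁ hr)
      _ ≤ B * r ^ (k + 1) := by
          have := pow_pos hr.1 (k + 1)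
          gcongr
          exact (le_max_left _ _).trans (le_max_right _ _)
      _ = _ := by ring
  have hq' : ∀ θ, ∀ r ∈ Ioc 0 R, |deriv (f θ) r / r ^ (k - 1) - k * P θ| ≤ B * r := fun θ r hr => by
    have hrk := pow_pos hr.1 (k - 1)
    have : deriv (f θ) r / r ^ (k - 1) - k * P θ =
        deriv (fun r : ℝ => e (r • (θ : E))) r / r ^ (k - 1) := by rw [hf2]; field_simp; ring
    rw [this, abs_div, abs_of_pos hrk, div_le_iff₀ hrk]
    calc _ ≤ D * r ^ k := hD θ r (hRR₁ hr)
      _ ≤ B * r ^ k := by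
          have := pow_pos hr.1 k
          gcongr
          exact (le_max_right _ _).trans (le_max_right _ _)
      _ = _ := by rw [hkp]; ring
  have hqlow : ∀ θ, ∀ r ∈ Ioc 0 R, a ≤ f θ r / r ^ k := fun θ r hr => by
    have h1 := (abs_le.1 (hq θ r hr)).1
    have h2 := hBr r hr
    have h3 := hθ₀ θ
    linarith
  have hqup : ∀ θ, ∀ r ∈ Ioc 0 R, f θ r / r ^ k ≤ P θ₁ + a := fun θ r hr => by
    have h1 := (abs_le.1 (hq θ r hr)).2
    have h2 := hBr r hr
    have h3 := hθ₁ θ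
    linarith
  have hqlow' : ∀ θ, ∀ r ∈ Ioc 0 R, a ≤ deriv (f θ) r / r ^ (k - 1) := fun θ r hr => by
    have h1 := (abs_le.1 (hq' θ r hr)).1
    have h2 := hBr r hr
    have h3 := hθ₀ θ
    nlinarith
  have hlin : ∀ c : ℝ, ∀ (w : ℝ → ℝ), (∀ r ∈ Ioc 0 R, |w r - c| ≤ B * r) →
      Tendsto w (𝓝[>] 0) (𝓝 c) := fun c w hw => by
    rw [tendsto_iff_norm_sub_tendsto_zero]
    have h0 : Tendsto (fun r : ℝ => B * r) (𝓝[>] 0) (𝓝 0) := by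
      have : Continuous (fun r : ℝ => B * r) := by fun_prop
      simpa using (this.tendsto 0).mono_left nhdsWithin_le_nhds
    refine squeeze_zero' (Eventually.of_forall fun _ => norm_nonneg _) ?_ h0
    filter_upwards [Ioc_mem_nhdsGT hR0] with r hr using hw r hr
  -- the root
  set s : Metric.sphere (0 : E) 1 → ℝ → ℝ := fun θ r => f θ r ^ (k : ℝ)⁻¹ with hs
  set s' : Metric.sphere (0 : E) 1 → ℝ → ℝ := fun θ r =>
    deriv (f θ) r / (k * s θ r ^ (k - 1)) with hs'
  have hfpos : ∀ θ, ∀ r ∈ Ioc 0 R, 0 < f θ r := fun θ r hr => by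
    have := ha0.trans_le (hqlow θ r hr)
    exact (div_pos_iff_of_pos_right (pow_pos hr.1 k)).1 this
  have hspos : ∀ θ, ∀ r ∈ Ioc 0 R, 0 < s θ r := fun θ r hr => Real.rpow_pos_of_pos (hfpos θ r hr) _
  have hf0 : ∀ θ, f θ 0 = 0 := fun θ => by
    have h1 : e 0 = 0 := by
      have := hball 0 (Metric.mem_ball_self hε)
      simpa using this
    have := hf1 θ 0
    rwa [zero_smul, h1, zero_pow hk, zero_mul, add_zero] at this
  have hspow : ∀ θ, ∀ r ∈ Icc 0 R, s θ r ^ k = f θ r := fun θ r hr => by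
    refine Real.rpow_inv_natCast_pow ?_ hk
    rcases hr.1.eq_or_lt with h | h
    · rw [← h, hf0]
    · exact (hfpos θ r ⟨h, hr.2⟩).le
  have hsr : ∀ θ, ∀ r ∈ Ioc 0 R, s θ r / r = (f θ r / r ^ k) ^ (k : ℝ)⁻¹ := fun θ r hr => by
    rw [Real.div_rpow (hfpos θ r hr).le (pow_pos hr.1 k).le, Real.pow_rpow_inv_natCast hr.1.le hk]
  -- Both `f'` and `s ^ (k - 1)` vanish to order `k - 1` at `0`. Dividing each by `r ^ (k - 1)`
  -- gives factors that have jets, the second one bounded away from `0`.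
  have hs'r : ∀ θ, ∀ r ∈ Ioc 0 R, s' θ r =
      deriv (f θ) r / r ^ (k - 1) * (k * (s θ r / r) ^ (k - 1))⁻¹ := fun θ r hr => by
    have h1 := hr.1.ne'
    have h2 := (hspos θ r hr).ne'
    simp only [hs', div_pow]
    field_simp
  set δ₁ := a ^ (k : ℝ)⁻¹ with hδ₁
  have hδ₁0 : 0 < δ₁ := Real.rpow_pos_of_pos ha0 _
  set M := (P θ₁ + a) ^ (k : ℝ)⁻¹ with hM
  have hM0 : 0 < M := Real.rpow_pos_of_pos (add_pos (hpos _ (hθ0 θ₁)) ha0) _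
  set δ₂ := a * (k * M ^ (k - 1))⁻¹ with hδ₂
  have hk0 : (0 : ℝ) < k := by linarith
  have hδ₂0 : 0 < δ₂ := by positivity
  have hslow : ∀ θ, ∀ r ∈ Ioc 0 R, δ₁ ≤ s θ r / r := fun θ r hr => by
    rw [hsr θ r hr]
    exact Real.rpow_le_rpow ha0.le (hqlow θ r hr) (by positivity)
  have hsup : ∀ θ, ∀ r ∈ Ioc 0 R, s θ r / r ≤ M := fun θ r hr => by
    rw [hsr θ r hr]
    exact Real.rpow_le_rpow (ha0.le.trans (hqlow θ r hr)) (hqup θ r hr) (by positivity)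
  have hs'low : ∀ θ, ∀ r ∈ Ioc 0 R, δ₂ ≤ s' θ r := fun θ r hr => by
    rw [hs'r θ r hr]
    have h1 := hsup θ r hr
    have h2 := hδ₁0.trans_le (hslow θ r hr)
    have h3 := hqlow' θ r hr
    have h4 : (k * M ^ (k - 1))⁻¹ ≤ (k * (s θ r / r) ^ (k - 1))⁻¹ := by gcongr
    exact mul_le_mul h3 h4 (by positivity) (ha0.le.trans h3)
  have hdc : ∀ θ, ContDiff ℝ ∞ (deriv (f θ)) := fun θ => by
    simpa using (hfc θ).iterate_deriv 1
  have hfjet : ∀ J, UniformJet R J f :=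
    uniformJet_of_contDiff hR0 hfc (exists_abs_iteratedDeriv_ray_le hF R)
  have hdjet : ∀ J, UniformJet R J (fun θ => deriv (f θ)) :=
    uniformJet_of_contDiff hR0 hdc fun m => by
      simpa only [← iteratedDeriv_succ'] using exists_abs_iteratedDeriv_ray_le hF R (m + 1)
  have hqjet : ∀ J, UniformJet R J (fun θ r => f θ r / r ^ k) := fun J => by
    refine (hfjet (J + k)).div_pow (C := P θ₁ + a) fun θ r hr => ?_
    rw [abs_of_pos (hfpos θ r hr), ← div_le_iff₀ (pow_pos hr.1 k)]
    exact hqup θ r hr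
  have hq'jet : ∀ J, UniformJet R J (fun θ r => deriv (f θ) r / r ^ (k - 1)) := fun J => by
    refine (hdjet (J + (k - 1))).div_pow (C := k * P θ₁ + a) fun θ r hr => ?_
    have h1 := ha0.trans_le (hqlow' θ r hr)
    have h2 := (abs_le.1 (hq' θ r hr)).2
    have h3 := hBr r hr
    have h4 : k * P θ ≤ k * P θ₁ := mul_le_mul_of_nonneg_left (hθ₁ θ) hk0.le
    rw [abs_of_pos ((div_pos_iff_of_pos_right (pow_pos hr.1 _)).1 h1),
      ← div_le_iff₀ (pow_pos hr.1 _)]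
    linarith
  have hsjet : ∀ J, UniformJet R J (fun θ r => s θ r / r) := fun J =>
    UniformJet.of_pow hk ((hqjet J).congr fun θ r hr => by
      rw [div_pow, hspow θ r (Ioc_subset_Icc_self hr)]) hδ₁0 hslow
  have hs'jet : ∀ J, UniformJet R J s' := fun J => by
    refine ((hq'jet J).mul (((UniformJet.const (b := fun _ => (k : ℝ)) ⟨k, by simp⟩).mul
      ((hsjet J).pow (k - 1))).inv (δ := k * δ₁ ^ (k - 1)) (by positivity)
      fun θ r hr => ?_)).congr fun θ r hr => (hs'r θ r hr).symm
    have := hslow θ r hr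
    gcongr
  have hslim : ∀ θ, Tendsto (fun r => s θ r / r) (𝓝[>] 0) (𝓝 (P θ ^ (k : ℝ)⁻¹)) := fun θ => by
    refine ((hlin _ _ (hq θ)).rpow_const (p := (k : ℝ)⁻¹)
      (Or.inr (by positivity))).congr' ?_
    filter_upwards [Ioc_mem_nhdsGT hR0] with r hr using (hsr θ r hr).symm
  refine ⟨R, min δ₁ δ₂, s, s', (min_le_left _ _).trans (min_le_left _ _), ?_, hspow, ?_⟩
  · exact
    { radius_pos := hR0
      slope_pos := lt_min hδ₁0 hδ₂0
      map_zero := fun θ => by simp only [hs, hf0]; exact Real.zero_rpow (by positivity)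
      continuousOn := fun θ =>
        ((hfc θ).continuous.rpow_const fun _ => Or.inr (by positivity)).continuousOn
      hasDerivAt := fun θ r hr => by
        have hr' := Ioo_subset_Ioc_self hr
        have h1 := (((hfc θ).differentiable (by simp)) r).hasDerivAt.rpow_const
          (p := (k : ℝ)⁻¹) (Or.inl (hfpos θ r hr').ne')
        convert h1 using 1
        rw [Real.rpow_sub_one (hfpos θ r hr').ne']
        change _ = deriv (f θ) r * (k : ℝ)⁻¹ * (s θ r / f θ r)
        rw [← hspow θ r (Ioc_subset_Icc_self hr'), hkp]
        have := (hspos θ r hr').ne'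
        simp only [hs']
        field_simp
      continuousOn_deriv := fun θ => by
        refine (hdc θ).continuous.continuousOn.div (ContinuousOn.mul continuousOn_const
          (ContinuousOn.pow ?_ _)) fun r hr => ?_
        · exact ((hfc θ).continuous.rpow_const fun _ => Or.inr (by positivity)).continuousOn
        · have := hspos θ r hr
          positivity
      le_self := fun θ r hr => by
        rw [← le_div_iff₀ hr.1]
        exact (min_le_left _ _).trans (hslow θ r hr)
      le_deriv := fun θ r hr => (min_le_right _ _).trans (hs'low θ r hr)
      jet := hsjet
      jet_deriv := hs'jet }
  · intro m θ
    have hPθ := hpos _ (hθ0 θ)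
    set q := P θ ^ (k : ℝ)⁻¹ with hqdef
    have hq0 : 0 < q := Real.rpow_pos_of_pos hPθ _
    have hqk : q ^ k = P θ := Real.rpow_inv_natCast_pow hPθ.le hk
    have h1 : Tendsto (s' θ) (𝓝[>] 0) (𝓝 (k * P θ * (k * q ^ (k - 1))⁻¹)) := by
      refine ((hlin _ _ (hq' θ)).mul ((tendsto_const_nhds.mul ((hslim θ).pow (k - 1))).inv₀
        (by positivity))).congr' ?_
      filter_upwards [Ioc_mem_nhdsGT hR0] with r hr using (hs'r θ r hr).symm
    have h2 : k * P θ * (k * q ^ (k - 1))⁻¹ = q := by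
      rw [← hqk, hkp]
      field_simp
    rw [h2] at h1
    rw [pow_succ]
    exact ((hslim θ).pow m).mul h1

end Rays

/-! ### Integration over the sphere and polar coordinates. -/

/-- Uniform bounds and a finite measure allow termwise integration. The coefficients are measurable
as pointwise limits of measurable functions. -/
theorem UniformJet.integral {ι : Type*} [MeasurableSpace ι] {σ : Measure ι} [IsFiniteMeasure σ]
    {R : ℝ} (hR : 0 < R) {J : ℕ} {u : ι → ℝ → ℝ} (hu : UniformJet R J u)
    (hm : ∀ x, AEStronglyMeasurable (fun i => u i x) σ) :
    UniformJet R J (fun (_ : Unit) x => ∫ i, u i x ∂σ) := by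
  induction J generalizing u with
  | zero =>
    obtain ⟨C, hC⟩ := hu
    refine ⟨C * σ.real univ, fun _ x hx => ?_⟩
    rw [← Real.norm_eq_abs]
    exact norm_integral_le_of_norm_le_const (Eventually.of_forall fun i => hC i x hx)
  | succ J ih =>
    obtain ⟨l, hl⟩ := hu.exists_tendsto hR
    obtain ⟨C, hC⟩ := hu.bounded
    obtain ⟨⟨D, hD⟩, hjet⟩ := hu.sub_lim_div hR hl
    have hlm : AEStronglyMeasurable l σ :=
      aestronglyMeasurable_of_tendsto_ae (𝓝[>] (0 : ℝ)) hm (Eventually.of_forall hl)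
    have hli : Integrable l σ := Integrable.of_bound hlm D (Eventually.of_forall hD)
    refine UniformJet.of_sub_div (l := fun _ => ∫ i, l i ∂σ) ⟨|∫ i, l i ∂σ|, fun _ => le_rfl⟩
      ((ih hjet fun x => by
        simpa only [div_eq_mul_inv, Pi.sub_apply] using ((hm x).sub hlm).mul_const x⁻¹).congr fun _ x hx => ?_)
    have hui : Integrable (fun i => u i x) σ :=
      Integrable.of_bound (hm x) C (Eventually.of_forall fun i => hC i x hx)
    rw [integral_div, integral_sub hui hli]

section Amplitude

variable {E : Type*} [NormedAddCommGroup E] [NormedSpace ℝ E]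

/-- The amplitude `A` is smooth, and all derivatives of `A t` decrease faster than any power of
`t`. -/
structure IsRapidAmplitude (A : ℝ → E → ℝ) : Prop where
  contDiff : ContDiff ℝ ∞ (Function.uncurry A)
  bound : ∀ N m : ℕ, ∃ C, ∀ t y, (1 + |t|) ^ N * ‖iteratedFDeriv ℝ m (A t) y‖ ≤ C

theorem IsRapidAmplitude.contDiff_apply {A : ℝ → E → ℝ} (hA : IsRapidAmplitude A) (t : ℝ) :
    ContDiff ℝ ∞ (A t) :=
  hA.contDiff.comp (contDiff_const.prodMk contDiff_id)

/-- The parameter is the pair `(θ, t)`. The weight is constant in `r`, and the decay of `A` makes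
the bounds uniform in `t`. -/
theorem IsRapidAmplitude.uniformJet {A : ℝ → E → ℝ} (hA : IsRapidAmplitude A) {R : ℝ} (hR : 0 < R)
    (N J : ℕ) : UniformJet R J (fun (q : Metric.sphere (0 : E) 1 × ℝ) r =>
      (1 + |q.2|) ^ N * A q.2 (r • (q.1 : E))) := by
  refine uniformJet_of_contDiff hR
    (fun q : Metric.sphere (0 : E) 1 × ℝ => contDiff_const.mul (contDiff_ray (hA.contDiff_apply q.2) q.1)) (fun m => ?_) J
  obtain ⟨C, hC⟩ := hA.bound N m
  refine ⟨C, fun q r _ => ?_⟩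
  rw [iteratedDeriv_const_mul_field ((1 + |q.2|) ^ N), abs_mul,
    abs_of_nonneg (by positivity : (0 : ℝ) ≤ (1 + |q.2|) ^ N)]
  exact (mul_le_mul_of_nonneg_left (abs_iteratedDeriv_ray_le (hA.contDiff_apply q.2) q.1 m r)
    (by positivity)).trans (hC q.2 _)

end Amplitude

section Polar

variable {E : Type*} [NormedAddCommGroup E] [NormedSpace ℝ E] [MeasurableSpace E] [BorelSpace E]
  [FiniteDimensional ℝ E] [Nontrivial E]

theorem integral_polar (μ : Measure E) [μ.IsAddHaarMeasure] {H : E → ℝ} (hH : Continuous H) {R : ℝ}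
    (hR : 0 < R) (hsupp : ∀ y, R ≤ ‖y‖ → H y = 0) :
    ∫ y, H y ∂μ = ∫ θ : Metric.sphere (0 : E) 1,
      (∫ r in (0 : ℝ)..R, H (r • (θ : E)) * r ^ (Module.finrank ℝ E - 1)) ∂μ.toSphere := by
  have : ProperSpace E := FiniteDimensional.proper ℝ E
  have hHi : Integrable H μ := hH.integrable_of_hasCompactSupport
    (HasCompactSupport.intro (isCompact_closedBall (0 : E) R) fun y hy => hsupp y (by
      rw [mem_closedBall_zero_iff, not_le] at hy
      exact hy.le))
  set g : Metric.sphere (0 : E) 1 × Ioi (0 : ℝ) → ℝ := fun p => H ((p.2 : ℝ) • (p.1 : E)) with hg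
  have hgH : ∀ x : ({(0)}ᶜ : Set E), g (homeomorphUnitSphereProd E x) = H x := fun x => by
    have : ‖(x : E)‖ ≠ 0 := norm_ne_zero_iff.2 x.2
    simp [hg, smul_smul, this]
  have hmp := μ.measurePreserving_homeomorphUnitSphereProd
  have hemb := (homeomorphUnitSphereProd E).measurableEmbedding
  have hgi : Integrable g (μ.toSphere.prod (.volumeIoiPow (Module.finrank ℝ E - 1))) := by
    rw [← hmp.integrable_comp_emb hemb]
    have : (g ∘ homeomorphUnitSphereProd E) = H ∘ Subtype.val := funext hgH
    rw [this, ← integrableOn_iff_comap_subtypeVal (measurableSet_singleton _).compl]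
    exact hHi.integrableOn
  calc ∫ y, H y ∂μ = ∫ x : ({(0)}ᶜ : Set E), H x ∂(μ.comap (↑)) := by
        rw [integral_subtype_comap (measurableSet_singleton _).compl H,
          restrict_compl_singleton]
    _ = ∫ p, g p ∂μ.toSphere.prod (.volumeIoiPow (Module.finrank ℝ E - 1)) := by
        rw [← hmp.integral_comp hemb]
        simp only [hgH]
    _ = ∫ θ, ∫ r, g (θ, r) ∂.volumeIoiPow (Module.finrank ℝ E - 1) ∂μ.toSphere :=
        integral_prod _ hgi
    _ = _ := by
        refine integral_congr_ae (Eventually.of_forall fun θ => ?_)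
        simp only [Measure.volumeIoiPow, ENNReal.ofReal]
        rw [integral_withDensity_eq_integral_smul
            ((measurable_subtype_coe.pow_const _).real_toNNReal),
          integral_subtype_comap measurableSet_Ioi
            fun r => Real.toNNReal (r ^ (Module.finrank ℝ E - 1)) • H (r • (θ : E)),
          intervalIntegral.integral_of_le hR.le]
        rw [setIntegral_eq_of_subset_of_forall_sdiff_eq_zero measurableSet_Ioi
          (s := Ioc 0 R) Ioc_subset_Ioi_self fun r hr => ?_]
        · refine setIntegral_congr_fun measurableSet_Ioc fun r hr => ?_
          simp only [NNReal.smul_def]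
          rw [Real.coe_toNNReal _ (pow_nonneg hr.1.le _), smul_eq_mul, mul_comm]
        · have h1 : R < r := by
            by_contra h
            exact hr.2 ⟨hr.1, not_lt.1 h⟩
          rw [hsupp _ (by simpa [norm_smul] using h1.le.trans (le_abs_self r)), smul_zero]

/-- Laplace type expansion at a nondegenerate minimum of order `k`, in the variable
`x = z ^ (-1/k)`. -/
theorem exists_uniformJet_integral (μ : Measure E) [μ.IsAddHaarMeasure] {k : ℕ} (hk : k ≠ 0)
    {F P : E → ℝ} (hF : ContDiff ℝ ∞ F) (hP : ContDiff ℝ ∞ P)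
    (hhom : ∀ (r : ℝ) v, P (r • v) = r ^ k * P v) (hpos : ∀ v, v ≠ 0 → 0 < P v)
    (hFP : (fun y => F y - P y) =O[𝓝 0] fun y => ‖y‖ ^ (k + 1)) {R₀ : ℝ} (hR₀ : 0 < R₀) :
    ∃ R, 0 < R ∧ R ≤ R₀ ∧ ∀ A : ℝ → E → ℝ, IsRapidAmplitude A → (∀ t y, R ≤ ‖y‖ → A t y = 0) →
      (∀ J, UniformJet 1 J (fun (_ : Unit) x =>
        (x ^ Module.finrank ℝ E)⁻¹ * ∫ y, A (F y / x ^ k) y ∂μ)) ∧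
      ∃ C, ∀ x ∈ Ioc (0 : ℝ) 1,
        |(x ^ Module.finrank ℝ E)⁻¹ * ∫ y, A (F y / x ^ k) y ∂μ -
          (∫ σ in Ioi (0 : ℝ), A (σ ^ k) 0 * σ ^ (Module.finrank ℝ E - 1)) *
            ∫ θ : Metric.sphere (0 : E) 1,
              ((P θ ^ (k : ℝ)⁻¹) ^ Module.finrank ℝ E)⁻¹ ∂μ.toSphere| ≤ C * x := by
  obtain ⟨R, δ, s, s', hRR₀, hphase, hsk, hlim⟩ :=
    exists_isRadialPhase hk hF hP hhom hpos hFP hR₀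
  have hR := hphase.radius_pos
  refine ⟨R, hR, hRR₀, fun A hA hsupp => ?_⟩
  set d := Module.finrank ℝ E with hd
  have hd1 : d - 1 + 1 = d := Nat.sub_add_cancel Module.finrank_pos
  have hAc : Continuous (Function.uncurry A) := hA.contDiff.continuous
  -- the radial integrals, and their integral over the sphere
  set inner : Metric.sphere (0 : E) 1 → ℝ → ℝ := fun θ x =>
    (x ^ d)⁻¹ * ∫ r in (0 : ℝ)..R, A (F (r • (θ : E)) / x ^ k) (r • (θ : E)) * r ^ (d - 1)
    with hinner
  have hinnerc : ∀ x, Continuous (fun θ => inner θ x) := fun x => by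
    refine continuous_const.mul
      (intervalIntegral.continuous_parametric_intervalIntegral_of_continuous' ?_ 0 R)
    have h1 : Continuous fun p : Metric.sphere (0 : E) 1 × ℝ => p.2 • (p.1 : E) :=
      continuous_snd.smul (continuous_subtype_val.comp continuous_fst)
    exact (hAc.comp (((hF.continuous.comp h1).div_const _).prodMk h1)).mul
      (continuous_snd.pow _)
  have hint : ∀ x, (x ^ d)⁻¹ * ∫ y, A (F y / x ^ k) y ∂μ = ∫ θ, inner θ x ∂μ.toSphere := fun x => by
    rw [integral_polar μ (H := fun y => A (F y / x ^ k) y) (hAc.comp ((hF.continuous.div_const _).prodMk continuous_id)) hR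
      (fun y hy => hsupp _ y hy), ← integral_const_mul]
  -- The weight is inserted and cancelled, so the integral does not depend on `N`, which may then be
  -- chosen according to the order `J`.
  have hrad : ∀ N θ x, radialIntegral R s k (d - 1) N
      (fun (θ : Metric.sphere (0 : E) 1) t r => (1 + |t|) ^ N * A t (r • (θ : E))) θ x =
        inner θ x := fun N θ x => by
    simp only [radialIntegral, hinner, hd1]
    congr 1
    rw [intervalIntegral.integral_of_le hR.le, intervalIntegral.integral_of_le hR.le]
    refine setIntegral_congr_fun measurableSet_Ioc fun r hr => ?_
    have h1 : (s θ r / x) ^ k = F (r • (θ : E)) / x ^ k := by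
      rw [div_pow, hsk θ r (Ioc_subset_Icc_self hr)]
    simp only [h1]
    rw [inv_mul_cancel_left₀]
    positivity
  have hcont : ∀ (N : ℕ) (θ : Metric.sphere (0 : E) 1), ContinuousOn
      (fun q : ℝ × ℝ => (1 + |q.1|) ^ N * A q.1 (q.2 • (θ : E))) (univ ×ˢ Ioc 0 R) := fun N θ => by
    have h1 : Continuous fun q : ℝ × ℝ => A q.1 (q.2 • (θ : E)) :=
      hAc.comp (continuous_fst.prodMk (continuous_snd.smul continuous_const))
    exact (Continuous.mul (by fun_prop) h1).continuousOn
  have hjet : ∀ J, UniformJet 1 J inner := fun J =>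
    (hphase.uniformJet_radialIntegral hk (m := d - 1) (N := d - 1 + J + 2) le_rfl
      (u := fun θ t r => (1 + |t|) ^ (d - 1 + J + 2) * A t (r • (θ : E)))
      (hA.uniformJet hR _ J) (hcont _)).congr fun θ x _ => hrad _ θ x
  refine ⟨fun J => ?_, ?_⟩
  · simp only [hint]
    exact (hjet J).integral one_pos fun x => (hinnerc x).aestronglyMeasurable
  · set N := d - 1 + (0 + 1) + 2 with hN
    obtain ⟨-, C, hC⟩ := hphase.radialIntegral_step hk (m := d - 1) (N := N) (J := 0) le_rfl
      (u := fun θ t r => (1 + |t|) ^ N * A t (r • (θ : E)))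
      (hA.uniformJet hR _ 1) (hcont _)
      (fun hv hvc => hphase.uniformJet_radialIntegral hk (by omega) hv hvc)
      (l := fun θ t => (1 + |t|) ^ N * A t 0 / (P θ ^ (k : ℝ)⁻¹) ^ d) fun θ t => by
        have h1 := hlim (d - 1) θ
        rw [hd1] at h1
        refine Tendsto.div ?_ h1 ?_
        · have : Continuous fun r : ℝ => (1 + |t|) ^ N * A t (r • (θ : E)) :=
            continuous_const.mul ((contDiff_ray (hA.contDiff_apply t) θ).continuous)
          simpa using (this.tendsto 0).mono_left nhdsWithin_le_nhds
        · exact (pow_pos (Real.rpow_pos_of_pos (hpos _ (ne_zero_of_mem_unit_sphere θ)) _) _).ne'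
    have hPc : Continuous fun θ : Metric.sphere (0 : E) 1 => ((P θ ^ (k : ℝ)⁻¹) ^ d)⁻¹ := by
      refine ((Continuous.rpow_const (hP.continuous.comp continuous_subtype_val)
        fun θ => Or.inr (by positivity)).pow d).inv₀ fun θ => ?_
      exact (pow_pos (Real.rpow_pos_of_pos (hpos _ (ne_zero_of_mem_unit_sphere θ)) _) _).ne'
    have : ProperSpace E := FiniteDimensional.proper ℝ E
    have hL : ∀ θ : Metric.sphere (0 : E) 1, (∫ σ in Ioi (0 : ℝ), ((1 + |σ ^ k|) ^ N)⁻¹ *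
        ((1 + |σ ^ k|) ^ N * A (σ ^ k) 0 / (P θ ^ (k : ℝ)⁻¹) ^ d) * σ ^ (d - 1)) =
        (∫ σ in Ioi (0 : ℝ), A (σ ^ k) 0 * σ ^ (d - 1)) * ((P θ ^ (k : ℝ)⁻¹) ^ d)⁻¹ := fun θ => by
      rw [← integral_mul_const]
      refine integral_congr_ae (Eventually.of_forall fun σ => ?_)
      have : (1 + |σ ^ k|) ^ N ≠ 0 := by positivity
      field_simp
    refine ⟨C * μ.toSphere.real univ, fun x hx => ?_⟩
    have hcompact : ∀ w : Metric.sphere (0 : E) 1 → ℝ, Continuous w → Integrable w μ.toSphere :=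
      fun w hw => hw.integrable_of_hasCompactSupport (HasCompactSupport.of_compactSpace w)
    rw [hint, ← integral_const_mul, ← integral_sub (hcompact _ (hinnerc x))
      ((hcompact _ hPc).const_mul _), mul_right_comm]
    rw [← Real.norm_eq_abs]
    refine norm_integral_le_of_norm_le_const (Eventually.of_forall fun θ => ?_)
    have h1 := hC θ x hx
    beta_reduce at h1
    rwa [hrad, hL, abs_div, abs_of_pos hx.1, div_le_iff₀ hx.1] at h1

end Polar

/-! ### Return to the large parameter, `x = z ^ (-1/k)`. -/

theorem rpow_neg_natCast_div {z : ℝ} (hz : 0 ≤ z) (j k : ℕ) :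
    z ^ (-(j : ℝ) / k) = (z ^ (-(k : ℝ)⁻¹)) ^ j := by
  rw [← Real.rpow_natCast, ← Real.rpow_mul hz]
  congr 1
  ring

theorem rpow_neg_inv_natCast_mem {z : ℝ} (hz : 1 ≤ z) (k : ℕ) :
    z ^ (-(k : ℝ)⁻¹) ∈ Ioc (0 : ℝ) 1 :=
  ⟨Real.rpow_pos_of_pos (by linarith) _,
    Real.rpow_le_one_of_one_le_of_nonpos hz (by simp)⟩

theorem integral_pow_substitution {k d : ℕ} (hk : k ≠ 0) (hd : d ≠ 0) (h : ℝ → ℝ) :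
    ∫ σ in Ioi (0 : ℝ), h (σ ^ k) * σ ^ (d - 1) =
      (1 / (k : ℝ)) * ∫ t in Ioi (0 : ℝ), t ^ (((d : ℝ) - k) / k) * h t := by
  have hk0 : (0 : ℝ) < k := by exact_mod_cast Nat.pos_of_ne_zero hk
  rw [← integral_comp_rpow_Ioi_of_pos (g := fun t => t ^ (((d : ℝ) - k) / k) * h t) hk0, ← integral_const_mul]
  refine setIntegral_congr_fun measurableSet_Ioi fun σ hσ => ?_
  have hσ0 : 0 < σ := hσ
  simp only [smul_eq_mul]
  rw [← Real.rpow_mul hσ0.le, mul_div_cancel₀ _ hk0.ne', Real.rpow_natCast]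
  have : σ ^ (d - 1) = σ ^ ((k : ℝ) - 1) * σ ^ ((d : ℝ) - k) := by
    rw [← Real.rpow_add hσ0, ← Real.rpow_natCast, Nat.cast_sub (Nat.one_le_iff_ne_zero.2 hd)]
    congr 1
    push_cast
    ring
  rw [this]
  field_simp

/-- Laplace type expansion at a nondegenerate minimum of order `k`. -/
theorem exists_hasAsymptoticExpansion {n k : ℕ} (hn : n ≠ 0) (hk : k ≠ 0)
    {F P : EuclideanSpace ℝ (Fin n) → ℝ} (hF : ContDiff ℝ ∞ F) (hP : ContDiff ℝ ∞ P)
    (hhom : ∀ (r : ℝ) v, P (r • v) = r ^ k * P v) (hpos : ∀ v, v ≠ 0 → 0 < P v)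
    (hFP : (fun y => F y - P y) =O[𝓝 0] fun y => ‖y‖ ^ (k + 1)) {R₀ : ℝ} (hR₀ : 0 < R₀) :
    ∃ R, 0 < R ∧ R ≤ R₀ ∧ ∀ A : ℝ → EuclideanSpace ℝ (Fin n) → ℝ, IsRapidAmplitude A →
      (∀ t y, R ≤ ‖y‖ → A t y = 0) →
      (∃ c, HasAsymptoticExpansion k (fun z => ∫ y, A (z * F y) y) c) ∧
      (fun z : ℝ => (∫ y, A (z * F y) y) - z ^ (-(n : ℝ) / k) *
        (pairingPlus (((n : ℝ) - k) / k) (fun t => A t 0) * ((1 / (k : ℝ)) *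
          ∫ θ : Metric.sphere (0 : EuclideanSpace ℝ (Fin n)) 1, |P θ| ^ (-(n : ℝ) / k)
            ∂(volume : Measure (EuclideanSpace ℝ (Fin n))).toSphere)))
        =O[atTop] fun z : ℝ => z ^ (-((n : ℝ) + 1) / k) := by
  have : NeZero n := ⟨hn⟩
  obtain ⟨R, hR, hRR₀, hcore⟩ := exists_uniformJet_integral
    (volume : Measure (EuclideanSpace ℝ (Fin n))) hk hF hP hhom hpos hFP hR₀
  refine ⟨R, hR, hRR₀, fun A hA hsupp => ?_⟩
  obtain ⟨hjet, C, hC⟩ := hcore A hA hsupp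
  simp only [finrank_euclideanSpace, Fintype.card_fin] at hjet hC
  set I : ℝ → ℝ := fun x => ∫ y, A (F y / x ^ k) y with hI
  have hIz : ∀ z : ℝ, 1 ≤ z → (∫ y, A (z * F y) y) = I (z ^ (-(k : ℝ)⁻¹)) := fun z hz => by
    have : (z ^ (-(k : ℝ)⁻¹)) ^ k = z⁻¹ := by
      rw [Real.rpow_neg (by linarith), inv_pow, Real.rpow_inv_natCast_pow (by linarith) hk]
    simp only [hI, this, div_inv_eq_mul, mul_comm]
  constructor
  -- Multiplication by `x ^ n` undoes the normalization and keeps jets of every order.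
  · have hIjet : ∀ J, UniformJet 1 J (fun _ : Unit => I) := fun J => by
      have hid : UniformJet 1 J (fun (_ : Unit) x => x) := by
        simpa using (UniformJet.const (J := J) (R := 1) (b := fun _ : Unit => (1 : ℝ))
          ⟨1, by simp⟩).id_mul.of_succ
      refine ((hid.pow n).mul (hjet J)).congr fun _ x hx => ?_
      rw [mul_inv_cancel_left₀ (pow_pos hx.1 n).ne']
    obtain ⟨c, hc⟩ := UniformJet.exists_expansion one_pos hIjet
    refine ⟨c, fun J => ?_⟩
    obtain ⟨D, hD⟩ := hc J
    refine Asymptotics.IsBigO.of_bound D ?_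
    filter_upwards [eventually_ge_atTop 1] with z hz
    have hz0 : 0 ≤ z := by linarith
    have hx := rpow_neg_inv_natCast_mem hz k
    simp only [rpow_neg_natCast_div hz0, hIz z hz, Real.norm_eq_abs]
    rw [abs_of_pos (pow_pos hx.1 J)]
    exact hD _ hx
  · have hlead : (∫ σ in Ioi (0 : ℝ), A (σ ^ k) 0 * σ ^ (n - 1)) *
        (∫ θ : Metric.sphere (0 : EuclideanSpace ℝ (Fin n)) 1, ((P θ ^ (k : ℝ)⁻¹) ^ n)⁻¹
          ∂(volume : Measure (EuclideanSpace ℝ (Fin n))).toSphere) =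
        pairingPlus (((n : ℝ) - k) / k) (fun t => A t 0) * ((1 / (k : ℝ)) *
          ∫ θ : Metric.sphere (0 : EuclideanSpace ℝ (Fin n)) 1, |P θ| ^ (-(n : ℝ) / k)
            ∂(volume : Measure (EuclideanSpace ℝ (Fin n))).toSphere) := by
      rw [integral_pow_substitution hk hn (fun t => A t 0), pairingPlus]
      have : ∀ θ : Metric.sphere (0 : EuclideanSpace ℝ (Fin n)) 1,
          ((P θ ^ (k : ℝ)⁻¹) ^ n)⁻¹ = |P θ| ^ (-(n : ℝ) / k) := fun θ => by
        have h0 := (hpos _ (ne_zero_of_mem_unit_sphere θ))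
        rw [abs_of_pos h0, rpow_neg_natCast_div h0.le, Real.rpow_neg h0.le, inv_pow]
      simp only [this]
      ring
    refine Asymptotics.IsBigO.of_bound C ?_
    filter_upwards [eventually_ge_atTop 1] with z hz
    have hz0 : 0 ≤ z := by linarith
    have hx := rpow_neg_inv_natCast_mem hz k
    have h1 := hC _ hx
    rw [← hlead, show -((n : ℝ) + 1) / k = -((n + 1 : ℕ) : ℝ) / k by push_cast; ring,
      rpow_neg_natCast_div hz0, rpow_neg_natCast_div hz0, hIz z hz, Real.norm_eq_abs,
      Real.norm_eq_abs, abs_of_pos (pow_pos hx.1 (n + 1))]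
    set x := z ^ (-(k : ℝ)⁻¹)
    have hxn := pow_pos hx.1 n
    rw [show I x - x ^ n * ((∫ σ in Ioi (0 : ℝ), A (σ ^ k) 0 * σ ^ (n - 1)) *
        (∫ θ : Metric.sphere (0 : EuclideanSpace ℝ (Fin n)) 1, ((P θ ^ (k : ℝ)⁻¹) ^ n)⁻¹
          ∂(volume : Measure (EuclideanSpace ℝ (Fin n))).toSphere)) = x ^ n * ((x ^ n)⁻¹ * I x -
        (∫ σ in Ioi (0 : ℝ), A (σ ^ k) 0 * σ ^ (n - 1)) *
        (∫ θ : Metric.sphere (0 : EuclideanSpace ℝ (Fin n)) 1, ((P θ ^ (k : ℝ)⁻¹) ^ n)⁻¹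
          ∂(volume : Measure (EuclideanSpace ℝ (Fin n))).toSphere)) by
        rw [mul_sub, mul_inv_cancel_left₀ hxn.ne'], abs_mul, abs_of_pos hxn]
    calc _ ≤ x ^ n * (C * x) := mul_le_mul_of_nonneg_left h1 hxn.le
      _ = _ := by ring

/-! ### Homogeneous polynomials as functions. -/

section Polynomial

variable {n k : ℕ} {p : MvPolynomial (Fin n) ℝ}

theorem contDiff_mvPolynomial_eval (p : MvPolynomial (Fin n) ℝ) :
    ContDiff ℝ ∞ fun v : EuclideanSpace ℝ (Fin n) => MvPolynomial.eval (fun i => v i) p := by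
  have hX : ∀ i, ContDiff ℝ ∞ fun v : EuclideanSpace ℝ (Fin n) => v i := fun i =>
    (EuclideanSpace.proj i : EuclideanSpace ℝ (Fin n) →L[ℝ] ℝ).contDiff
  induction p using MvPolynomial.induction_on with
  | C a => simpa using contDiff_const
  | add p q hp hq => simpa using hp.add hq
  | mul_X p i hp => simpa using hp.mul (hX i)

theorem MvPolynomial.IsHomogeneous.eval_smul_vec (hp : p.IsHomogeneous k) (r : ℝ)
    (v : EuclideanSpace ℝ (Fin n)) :
    MvPolynomial.eval (fun i => (r • v) i) p = r ^ k * MvPolynomial.eval (fun i => v i) p := by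
  rw [MvPolynomial.eval_eq', MvPolynomial.eval_eq', Finset.mul_sum]
  refine Finset.sum_congr rfl fun d hd => ?_
  have hdeg : ∑ i, d i = k := by
    have h1 := hp (MvPolynomial.mem_support_iff.1 hd)
    rw [← h1, ← Finsupp.degree_eq_sum, Finsupp.degree_eq_weight_one]
    rfl
  simp only [PiLp.smul_apply, smul_eq_mul, mul_pow, Finset.prod_mul_distrib,
    Finset.prod_pow_eq_pow_sum, hdeg]
  ring

/-- In no variables the only monomial has degree `0`. This excludes dimension `0`, where there is no
sphere to integrate over. -/
theorem MvPolynomial.IsHomogeneous.ne_zero_of_pos (hp : p.IsHomogeneous k) (h0 : p ≠ 0)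
    (hk : k ≠ 0) : n ≠ 0 := by
  rintro rfl
  obtain ⟨d, hd⟩ := MvPolynomial.ne_zero_iff.1 h0
  have h1 := hp hd
  rw [Subsingleton.elim d 0, map_zero] at h1
  exact hk h1.symm

end Polynomial

/-! ### Leading parts, smooth extension, amplitudes. -/

section Local

variable {E : Type*} [NormedAddCommGroup E] [NormedSpace ℝ E]

/-- The homogeneous leading part of a nonnegative function is nonnegative. -/
theorem leadingPart_nonneg {k : ℕ} {h P : E → ℝ} (hhom : ∀ (r : ℝ) v, P (r • v) = r ^ k * P v)
    (hhP : (fun y => h y - P y) =O[𝓝 0] fun y => ‖y‖ ^ (k + 1)) (h0 : ∀ᶠ y in 𝓝 0, 0 ≤ h y)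
    (v : E) : 0 ≤ P v := by
  obtain ⟨C, hC⟩ := hhP.bound
  have hlim : Tendsto (fun r : ℝ => r • v) (𝓝[>] 0) (𝓝 0) := by
    have : Continuous fun r : ℝ => r • v := by fun_prop
    simpa using (this.tendsto 0).mono_left nhdsWithin_le_nhds
  have h1 : Tendsto (fun r : ℝ => -(C * ‖v‖ ^ (k + 1) * r)) (𝓝[>] 0) (𝓝 0) := by
    have : Continuous fun r : ℝ => -(C * ‖v‖ ^ (k + 1) * r) := by fun_prop
    simpa using (this.tendsto 0).mono_left nhdsWithin_le_nhds
  refine le_of_tendsto h1 ?_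
  filter_upwards [hlim.eventually hC, hlim.eventually h0, self_mem_nhdsWithin] with r h2 h3 hr
  have hr0 : 0 < r := hr
  rw [hhom, norm_smul, Real.norm_of_nonneg hr0.le, Real.norm_eq_abs, Real.norm_eq_abs,
    abs_of_nonneg (by positivity : 0 ≤ (r * ‖v‖) ^ (k + 1))] at h2
  have h4 := (abs_le.1 h2).2
  -- From `0 ≤ h(r v) ≤ r ^ k P v + C (r ‖v‖) ^ (k + 1)`; after division by `r ^ k` the error is
  -- `O(r)`.
  have h5 : r ^ k * -(C * ‖v‖ ^ (k + 1) * r) ≤ r ^ k * P v := by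
    have : C * (r * ‖v‖) ^ (k + 1) = r ^ k * (C * ‖v‖ ^ (k + 1) * r) := by ring
    rw [this] at h4
    linarith
  exact le_of_mul_le_mul_left h5 (pow_pos hr0 k)

/-- The open sets `Ω` and the complement of `K` cover `E`, and `h` is smooth on each. -/
theorem contDiff_of_eq_zero_off {F : Type*} [NormedAddCommGroup F] [NormedSpace ℝ F]
    {Ω K : Set E} (hΩ : IsOpen Ω) (hK : IsClosed K) (hKΩ : K ⊆ Ω)
    {h : E → F} (hh : ContDiffOn ℝ ∞ h Ω) (h0 : ∀ w, w ∉ K → h w = 0) : ContDiff ℝ ∞ h := by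
  rw [contDiff_iff_contDiffAt]
  intro w
  by_cases hw : w ∈ Ω
  · exact hh.contDiffAt (hΩ.mem_nhds hw)
  · refine (contDiffAt_const (c := (0 : F))).congr_of_eventuallyEq ?_
    filter_upwards [hK.isOpen_compl.mem_nhds fun h => hw (hKΩ h)] with w' hw' using h0 w' hw'

/-- A function that is smooth near `0` agrees near `0` with a smooth function. -/
theorem exists_contDiff_eq_of_contDiffOn [FiniteDimensional ℝ E] {Ω : Set E} (hΩ : IsOpen Ω)
    (h0 : 0 ∈ Ω) {h : E → ℝ} (hh : ContDiffOn ℝ ∞ h Ω) :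
    ∃ (F : E → ℝ) (R : ℝ), ContDiff ℝ ∞ F ∧ 0 < R ∧ ∀ w, ‖w‖ ≤ R → F w = h w ∧ w ∈ Ω := by
  obtain ⟨ε, hε, hball⟩ := Metric.isOpen_iff.1 hΩ 0 h0
  let χ : ContDiffBump (0 : E) := ⟨ε / 3, ε / 2, by positivity, by linarith⟩
  have hsub : tsupport χ ⊆ Ω := by
    rw [χ.tsupport_eq]
    refine (Metric.closedBall_subset_ball ?_).trans hball
    change ε / 2 < ε
    linarith
  refine ⟨fun w => χ w * h w, ε / 3, ?_, by positivity, fun w hw => ⟨?_, ?_⟩⟩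
  · refine contDiff_of_eq_zero_off hΩ (isClosed_tsupport χ) hsub
      (χ.contDiff.contDiffOn.mul hh) fun w hw => ?_
    rw [image_eq_zero_of_notMem_tsupport hw, zero_mul]
  · beta_reduce
    rw [χ.one_of_mem_closedBall (mem_closedBall_zero_iff.2 hw), one_mul]
  · refine hball ?_
    rw [mem_ball_zero_iff]
    linarith

theorem one_add_pow_le {a : ℝ} (ha : 0 ≤ a) (N : ℕ) : (1 + a) ^ N ≤ 2 ^ N * (1 + a ^ N) := by
  have hp := pow_nonneg ha N
  rcases le_total a 1 with h | h
  · calc (1 + a) ^ N ≤ 2 ^ N := pow_le_pow_left₀ (by linarith) (by linarith) N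
      _ ≤ 2 ^ N * (1 + a ^ N) := le_mul_of_one_le_right (by positivity) (by linarith)
  · calc (1 + a) ^ N ≤ (2 * a) ^ N := pow_le_pow_left₀ (by linarith) (by linarith) N
      _ = 2 ^ N * a ^ N := mul_pow _ _ _
      _ ≤ _ := by gcongr; linarith

theorem exists_one_add_pow_bound {α : Type*} {u : ℝ → α → ℝ} (hu0 : ∀ t y, 0 ≤ u t y) {s : Set α}
    (h : ∀ N : ℕ, ∃ C, ∀ t, ∀ y ∈ s, |t| ^ N * u t y ≤ C) (N : ℕ) :
    ∃ C, ∀ t, ∀ y ∈ s, (1 + |t|) ^ N * u t y ≤ C := by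
  obtain ⟨C, hC⟩ := h 0
  obtain ⟨D, hD⟩ := h N
  refine ⟨2 ^ N * (C + D), fun t y hy => ?_⟩
  have h1 := hC t y hy
  rw [pow_zero, one_mul] at h1
  calc _ ≤ 2 ^ N * (1 + |t| ^ N) * u t y :=
        mul_le_mul_of_nonneg_right (one_add_pow_le (abs_nonneg t) N) (hu0 t y)
    _ = 2 ^ N * (u t y + |t| ^ N * u t y) := by ring
    _ ≤ _ := by
        gcongr
        exact hD t y hy

/-- A symbol times a smooth function with compact support is a rapidly decreasing amplitude. -/
theorem isRapidAmplitude_mul {Ω K : Set E} (hΩ : IsOpen Ω) (hK : IsCompact K) (hKΩ : K ⊆ Ω)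
    {G : ℝ → E → ℝ} (hG : ContDiffOn ℝ ∞ (Function.uncurry G) (univ ×ˢ Ω))
    (hGb : ∀ N m : ℕ, ∃ C, ∀ t, ∀ y ∈ K, |t| ^ N * ‖iteratedFDeriv ℝ m (G t) y‖ ≤ C)
    {a : E → ℝ} (ha : ContDiffOn ℝ ∞ a Ω) (ha0 : ∀ w, w ∉ K → a w = 0) :
    IsRapidAmplitude fun t w => G t w * a w := by
  constructor
  · refine contDiff_of_eq_zero_off (isOpen_univ.prod hΩ) (isClosed_univ.prod hK.isClosed)
      (Set.prod_mono le_rfl hKΩ) (hG.mul (ha.comp contDiffOn_snd fun q hq => hq.2)) fun q hq => ?_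
    have : q.2 ∉ K := fun h => hq ⟨mem_univ _, h⟩
    simp [Function.uncurry, ha0 _ this]
  · intro N m
    have hGt : ∀ t, ContDiffOn ℝ ∞ (G t) Ω := fun t =>
      hG.comp (contDiffOn_const.prodMk contDiffOn_id) fun w hw => ⟨mem_univ _, hw⟩
    have hab : ∀ j : ℕ, ∃ D, ∀ y ∈ K, ‖iteratedFDeriv ℝ j a y‖ ≤ D := fun j => by
      refine hK.exists_bound_of_continuousOn (ContinuousOn.mono ?_ hKΩ)
      exact (ha.continuousOn_iteratedFDerivWithin (m := j) (by exact_mod_cast le_top)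
        hΩ.uniqueDiffOn).congr fun w hw => (iteratedFDerivWithin_of_isOpen j hΩ hw).symm
    choose D hD using hab
    have hGb' : ∀ j : ℕ, ∃ C, ∀ t, ∀ y ∈ K, (1 + |t|) ^ N * ‖iteratedFDeriv ℝ j (G t) y‖ ≤ C :=
      fun j => exists_one_add_pow_bound (fun _ _ => norm_nonneg _) (fun N => hGb N j) N
    choose C hC using hGb'
    -- The constant of the Leibniz formula on `K`. The absolute values make it nonnegative, as is
    -- needed at points off `K`.
    refine ⟨∑ i ∈ Finset.range (m + 1), |(m.choose i : ℝ) * C i * D (m - i)|, fun t y => ?_⟩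
    by_cases hy : y ∈ K
    · have hyΩ := hKΩ hy
      have h1 := norm_iteratedFDerivWithin_mul_le (hGt t) ha hΩ.uniqueDiffOn hyΩ (n := m)
        (by exact_mod_cast le_top)
      simp only [iteratedFDerivWithin_of_isOpen _ hΩ hyΩ] at h1
      refine (mul_le_mul_of_nonneg_left h1 (by positivity)).trans ?_
      rw [Finset.mul_sum]
      refine Finset.sum_le_sum fun i _ => le_trans ?_ (le_abs_self _)
      have h2 := hC i t y hy
      have h3 : 0 ≤ C i := le_trans (by positivity) h2
      calc _ = (m.choose i : ℝ) * ((1 + |t|) ^ N * ‖iteratedFDeriv ℝ i (G t) y‖) *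
            ‖iteratedFDeriv ℝ (m - i) a y‖ := by ring
        _ ≤ _ := by
          gcongr
          exact hD (m - i) y hy
    · have : (fun w => G t w * a w) =ᶠ[𝓝 y] fun _ => (0 : ℝ) := by
        filter_upwards [hK.isClosed.isOpen_compl.mem_nhds hy] with w hw
        rw [ha0 w hw, mul_zero]
      rw [(this.iteratedFDeriv ℝ m).eq_of_nhds, iteratedFDeriv_fun_zero, Pi.zero_apply,
        norm_zero, mul_zero]
      exact Finset.sum_nonneg fun i _ => abs_nonneg _

end Local

/-! ### Convergence and symmetry of the pairings. -/

/-- The substitution `t = σ ^ k` removes the possible singularity at `0`: the integrand becomes `k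
h(σ ^ k) σ ^ (n - 1)`. -/
theorem integrableOn_Ioi_rpow_mul {n k : ℕ} (hn : n ≠ 0) (hk : k ≠ 0) {h : ℝ → ℝ}
    (hc : Continuous h) (hb : ∀ N : ℕ, ∃ C, ∀ t, (1 + |t|) ^ N * |h t| ≤ C) :
    IntegrableOn (fun t : ℝ => |t| ^ (((n : ℝ) - k) / k) * h t) (Ioi 0) := by
  have hk0 : (0 : ℝ) < k := by exact_mod_cast Nat.pos_of_ne_zero hk
  rw [← integrableOn_Ioi_comp_rpow_iff _ hk0.ne']
  obtain ⟨C, hC⟩ := hb (n - 1 + 2)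
  have h1 := (IsRadialPhase.integrableOn_weight (m := n - 1) hk le_rfl
    (b := fun t => (1 + |t|) ^ (n - 1 + 2) * h t) (by fun_prop) (C := C) fun t => by
      rw [abs_mul, abs_of_nonneg (by positivity : (0 : ℝ) ≤ (1 + |t|) ^ (n - 1 + 2))]
      exact hC t).const_mul (k : ℝ)
  refine IntegrableOn.congr_fun h1 (fun σ hσ => ?_) measurableSet_Ioi
  have hσ0 : 0 < σ := hσ
  have hσk := pow_pos hσ0 k
  have e : σ ^ (n - 1) = σ ^ ((k : ℝ) - 1) * σ ^ ((n : ℝ) - k) := by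
    rw [← Real.rpow_add hσ0, ← Real.rpow_natCast, Nat.cast_sub (Nat.one_le_iff_ne_zero.2 hn)]
    congr 1
    push_cast
    ring
  simp only [smul_eq_mul, abs_of_pos hk0, Real.rpow_natCast, abs_of_pos hσk]
  rw [← Real.rpow_natCast σ k, ← Real.rpow_mul hσ0.le, mul_div_cancel₀ _ hk0.ne', e]
  have : (1 + σ ^ (k : ℝ)) ^ (n - 1 + 2) ≠ 0 := by positivity
  field_simp

theorem integrable_abs_rpow_mul {n k : ℕ} (hn : n ≠ 0) (hk : k ≠ 0) {h : ℝ → ℝ}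
    (hc : Continuous h) (hb : ∀ N : ℕ, ∃ C, ∀ t, (1 + |t|) ^ N * |h t| ≤ C) :
    Integrable (fun t : ℝ => |t| ^ (((n : ℝ) - k) / k) * h t) := by
  have h1 := integrableOn_Ioi_rpow_mul hn hk hc hb
  have h2 := integrableOn_Ioi_rpow_mul hn hk (hc.comp continuous_neg) fun N => by
    obtain ⟨C, hC⟩ := hb N
    exact ⟨C, fun t => by simpa using hC (-t)⟩
  have h3 : IntegrableOn (fun t : ℝ => |t| ^ (((n : ℝ) - k) / k) * h t) (Iio 0) := by
    rw [← integrable_indicator_iff measurableSet_Iio]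
    rw [← integrable_indicator_iff measurableSet_Ioi] at h2
    refine h2.comp_neg.congr (Eventually.of_forall fun t => ?_)
    by_cases ht : t < 0 <;> simp [indicator, ht]
  rw [← integrableOn_univ, ← Iic_union_Ioi (a := (0 : ℝ))]
  exact ((integrableOn_Iic_iff_integrableOn_Iio (by finiteness)).2 h3).union h1

theorem pairingMinus_eq (a : ℝ) (h : ℝ → ℝ) :
    pairingMinus a h = pairingPlus a fun t => h (-t) := by
  rw [pairingMinus, pairingPlus, ← integral_Iic_eq_integral_Iio, ← neg_zero,
    ← integral_comp_neg_Ioi]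
  simp

theorem pairingPlus_mul_const (a c : ℝ) (h : ℝ → ℝ) :
    pairingPlus a (fun t => h t * c) = pairingPlus a h * c := by
  rw [pairingPlus, pairingPlus, ← integral_mul_const]
  simp only [mul_assoc]

/-! ### Transfer from the manifold to centred coordinates. -/

section Chart

variable {n : ℕ} {X : Type*} [TopologicalSpace X]

/-- The inverse of the chart `φ`, in coordinates centered at `y₀`. -/
def centeredSymm (φ : OpenPartialHomeomorph X (EuclideanSpace ℝ (Fin n)))
    (y₀ w : EuclideanSpace ℝ (Fin n)) : X :=
  φ.symm (y₀ + w)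

/-- The range of the chart `φ`, in coordinates centered at `y₀`. -/
def centeredTarget (φ : OpenPartialHomeomorph X (EuclideanSpace ℝ (Fin n)))
    (y₀ : EuclideanSpace ℝ (Fin n)) : Set (EuclideanSpace ℝ (Fin n)) :=
  {w | y₀ + w ∈ φ.target}

variable {φ : OpenPartialHomeomorph X (EuclideanSpace ℝ (Fin n))} {y₀ : EuclideanSpace ℝ (Fin n)}

theorem isOpen_centeredTarget : IsOpen (centeredTarget φ y₀) :=
  φ.open_target.preimage (continuous_const.add continuous_id)

theorem integral_eq_setIntegral_centeredTarget [MeasurableSpace X] [BorelSpace X] {μ : Measure X}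
    {ρ : EuclideanSpace ℝ (Fin n) → ℝ} (hρ : IsChartDensity φ μ ρ) {h : X → ℝ} (hh : Continuous h)
    (hsupp : ∀ x, x ∉ φ.source → h x = 0) :
    ∫ x, h x ∂μ = ∫ w in centeredTarget φ y₀, h (centeredSymm φ y₀ w) * ρ (y₀ + w) := by
  have hms : MeasurableSet φ.source := φ.open_source.measurableSet
  have hmt : MeasurableSet φ.target := φ.open_target.measurableSet
  have hhφ : AEStronglyMeasurable (fun y => h (φ.symm y))
      ((volume.restrict φ.target).withDensity fun y => ENNReal.ofReal (ρ y)) :=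
    ((hh.comp_continuousOn φ.continuousOn_symm).aestronglyMeasurable hmt).mono_ac
      (withDensity_absolutelyContinuous _ _)
  calc ∫ x, h x ∂μ = ∫ x in φ.source, h x ∂μ :=
        (setIntegral_eq_integral_of_forall_compl_eq_zero (μ := μ) (f := h) hsupp).symm
    _ = ∫ x in φ.source, h (φ.symm (φ x)) ∂μ :=
        setIntegral_congr_fun hms fun x hx => by rw [φ.left_inv hx]
    _ = ∫ y, h (φ.symm y) ∂(μ.restrict φ.source).map φ := by
        refine (integral_map (μ := μ.restrict φ.source) (f := fun y => h (φ.symm y))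
          (φ.continuousOn.aemeasurable hms) ?_).symm
        rw [hρ.2.2]
        exact hhφ
    _ = ∫ y in φ.target, (ENNReal.ofReal (ρ y)).toReal • h (φ.symm y) := by
        rw [hρ.2.2, integral_withDensity_eq_integral_toReal_smul₀
          (hρ.1.continuousOn.aemeasurable hmt).ennreal_ofReal
          (Eventually.of_forall fun _ => ENNReal.ofReal_lt_top)]
    _ = ∫ y in φ.target, h (φ.symm y) * ρ y :=
        setIntegral_congr_fun hmt fun y hy => by
          simp only [smul_eq_mul]
          rw [ENNReal.toReal_ofReal (hρ.2.1 y hy).le, mul_comm]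
    _ = _ := by
        rw [← integral_indicator hmt, ← integral_indicator isOpen_centeredTarget.measurableSet,
          ← integral_add_left_eq_self _ y₀]
        rfl

/-- The cutoff `Θ` times the density `ρ`, in centered coordinates. -/
noncomputable def chartCutoff (φ : OpenPartialHomeomorph X (EuclideanSpace ℝ (Fin n)))
    (y₀ : EuclideanSpace ℝ (Fin n)) (ρ : EuclideanSpace ℝ (Fin n) → ℝ) (Θ : X → ℝ) :
    EuclideanSpace ℝ (Fin n) → ℝ :=
  (centeredTarget φ y₀).indicator fun w => Θ (centeredSymm φ y₀ w) * ρ (y₀ + w)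

theorem chartCutoff_eq_zero {ρ : EuclideanSpace ℝ (Fin n) → ℝ} {Θ : X → ℝ}
    {w : EuclideanSpace ℝ (Fin n)} (hw : y₀ + w ∉ φ '' tsupport Θ) :
    chartCutoff φ y₀ ρ Θ w = 0 := by
  by_cases hw' : w ∈ centeredTarget φ y₀
  · rw [chartCutoff, indicator_of_mem hw']
    have : Θ (centeredSymm φ y₀ w) = 0 := by
      refine image_eq_zero_of_notMem_tsupport fun h => hw ⟨_, h, ?_⟩
      exact φ.right_inv hw'
    rw [this, zero_mul]
  · rw [chartCutoff, indicator_of_notMem hw']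

/-- The amplitude obtained from the symbol `g` and the cutoff `Θ`, in centered coordinates. -/
noncomputable def chartAmplitude (φ : OpenPartialHomeomorph X (EuclideanSpace ℝ (Fin n)))
    (y₀ : EuclideanSpace ℝ (Fin n)) (ρ : EuclideanSpace ℝ (Fin n) → ℝ) (g : ℝ × X → ℝ) (Θ : X → ℝ)
    (ε t : ℝ) (w : EuclideanSpace ℝ (Fin n)) : ℝ :=
  g (ε * t, centeredSymm φ y₀ w) * chartCutoff φ y₀ ρ Θ w

/-- The sign `ε = ±1` enters twice, in the phase and in the symbol, and cancels. It lets a maximum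
of `f` be treated as a minimum of `-f`. -/
theorem singularPart_eq_integral_chartAmplitude [MeasurableSpace X] [BorelSpace X] {μ : Measure X}
    {ρ : EuclideanSpace ℝ (Fin n) → ℝ} (hρ : IsChartDensity φ μ ρ) {f : X → ℝ} (hf : Continuous f)
    {g : ℝ × X → ℝ} (hg : Continuous g) {Θ : X → ℝ} (hΘ : Continuous Θ)
    (hΘs : tsupport Θ ⊆ φ.source) {ε : ℝ} (hε : ε * ε = 1) (z : ℝ) :
    singularPart μ f g Θ z =
      ∫ w, chartAmplitude φ y₀ ρ g Θ ε (z * (ε * f (centeredSymm φ y₀ w))) w := by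
  rw [singularPart, integral_eq_setIntegral_centeredTarget (y₀ := y₀) hρ
    (h := fun x => g (z * f x, x) * Θ x)
    ((hg.comp ((continuous_const.mul hf).prodMk continuous_id)).mul hΘ) fun x hx => by
      rw [image_eq_zero_of_notMem_tsupport fun h => hx (hΘs h), mul_zero],
    ← integral_indicator isOpen_centeredTarget.measurableSet]
  refine integral_congr_ae (Eventually.of_forall fun w => ?_)
  have h1 : ε * (z * (ε * f (centeredSymm φ y₀ w))) = z * f (centeredSymm φ y₀ w) := by
    linear_combination z * f (centeredSymm φ y₀ w) * hε
  simp only [chartAmplitude, chartCutoff, h1]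
  by_cases hw : w ∈ centeredTarget φ y₀
  · simp only [indicator_of_mem hw]
    ring
  · simp only [indicator_of_notMem hw, mul_zero]

variable [ChartedSpace (EuclideanSpace ℝ (Fin n)) X]

theorem contMDiffOn_centeredSymm (hφ : φ ∈ IsManifold.maximalAtlas (𝓡 n) ∞ X) :
    ContMDiffOn (𝓡 n) (𝓡 n) ∞ (centeredSymm φ y₀) (centeredTarget φ y₀) := by
  have h1 : ContMDiff (𝓡 n) (𝓡 n) ∞ fun w : EuclideanSpace ℝ (Fin n) => y₀ + w :=
    (contDiff_const.add contDiff_id).contMDiff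
  exact (contMDiffOn_symm_of_mem_maximalAtlas hφ).comp h1.contMDiffOn fun w hw => hw

theorem contDiffOn_comp_centeredSymm (hφ : φ ∈ IsManifold.maximalAtlas (𝓡 n) ∞ X) {h : X → ℝ}
    (hh : ContMDiff (𝓡 n) 𝓘(ℝ, ℝ) ∞ h) :
    ContDiffOn ℝ ∞ (fun w => h (centeredSymm φ y₀ w)) (centeredTarget φ y₀) :=
  contMDiffOn_iff_contDiffOn.1 (hh.comp_contMDiffOn (contMDiffOn_centeredSymm hφ))

theorem contDiffOn_symbol_comp_centeredSymm (hφ : φ ∈ IsManifold.maximalAtlas (𝓡 n) ∞ X)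
    {g : ℝ × X → ℝ} (hg : ContMDiff (𝓘(ℝ, ℝ).prod (𝓡 n)) 𝓘(ℝ, ℝ) ∞ g) (ε : ℝ) :
    ContDiffOn ℝ ∞ (fun q : ℝ × EuclideanSpace ℝ (Fin n) => g (ε * q.1, centeredSymm φ y₀ q.2))
      (univ ×ˢ centeredTarget φ y₀) := by
  have h1 : ContMDiffOn 𝓘(ℝ, ℝ × EuclideanSpace ℝ (Fin n)) 𝓘(ℝ, ℝ) ∞
      (fun q : ℝ × EuclideanSpace ℝ (Fin n) => ε * q.1) (univ ×ˢ centeredTarget φ y₀) :=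
    (contDiff_const.mul contDiff_fst).contMDiff.contMDiffOn
  have h2 : ContMDiffOn 𝓘(ℝ, ℝ × EuclideanSpace ℝ (Fin n)) (𝓡 n) ∞
      (fun q : ℝ × EuclideanSpace ℝ (Fin n) => q.2) (univ ×ˢ centeredTarget φ y₀) :=
    contDiff_snd.contMDiff.contMDiffOn
  exact contMDiffOn_iff_contDiffOn.1 (hg.comp_contMDiffOn
    (h1.prodMk ((contMDiffOn_centeredSymm (y₀ := y₀) hφ).comp h2 fun q hq => hq.2)))

theorem isRapidAmplitude_chartAmplitude (hφ : φ ∈ IsManifold.maximalAtlas (𝓡 n) ∞ X)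
    {ρ : EuclideanSpace ℝ (Fin n) → ℝ} (hρ : ContDiffOn ℝ ∞ ρ φ.target) {g : ℝ × X → ℝ}
    (hg : IsSymbol n g) {Θ : X → ℝ} (hΘ : ContMDiff (𝓡 n) 𝓘(ℝ, ℝ) ∞ Θ) (hΘc : HasCompactSupport Θ)
    (hΘs : tsupport Θ ⊆ φ.source) {ε : ℝ} (hε : |ε| = 1) :
    IsRapidAmplitude (chartAmplitude φ y₀ ρ g Θ ε) := by
  have hKc : IsCompact (φ '' tsupport Θ) :=
    IsCompact.image_of_continuousOn hΘc (φ.continuousOn.mono hΘs)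
  have hKt : φ '' tsupport Θ ⊆ φ.target := by
    rintro _ ⟨x, hx, rfl⟩
    exact φ.map_source (hΘs hx)
  have hK'c : IsCompact ((fun w => y₀ + w) ⁻¹' (φ '' tsupport Θ)) :=
    (Homeomorph.addLeft y₀).isCompact_preimage.2 hKc
  refine isRapidAmplitude_mul isOpen_centeredTarget hK'c (fun w hw => hKt hw)
    (G := fun t w => g (ε * t, centeredSymm φ y₀ w))
    (contDiffOn_symbol_comp_centeredSymm hφ hg.1 ε) (fun N m => ?_) ?_
    fun w hw => chartCutoff_eq_zero hw
  · obtain ⟨C, hC⟩ := hg.2 φ hφ _ hKc hKt N m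
    refine ⟨C, fun t w hw => ?_⟩
    have h1 := hC (ε * t) (y₀ + w) hw
    rw [← iteratedFDeriv_comp_add_left, abs_mul, hε, one_mul] at h1
    exact h1
  · refine ContDiffOn.congr ((contDiffOn_comp_centeredSymm hφ hΘ).mul
      (hρ.comp (contDiff_const.add contDiff_id).contDiffOn fun w hw => hw)) fun w hw => ?_
    rw [chartCutoff, indicator_of_mem hw]
    rfl

/-- The expansion of the singular part near a point where `ε * f` has a positive definite leading
part in the chart `φ`. -/
theorem exists_nhds_singularPart_expansion [MeasurableSpace X] [BorelSpace X] {k : ℕ} (hn : n ≠ 0)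
    (hk : k ≠ 0) {μ : Measure X} {f : X → ℝ} (hf : ContMDiff (𝓡 n) 𝓘(ℝ, ℝ) ∞ f) {x₀ : X}
    (hφ : φ ∈ IsManifold.maximalAtlas (𝓡 n) ∞ X) (hφx₀ : x₀ ∈ φ.source)
    {ρ : EuclideanSpace ℝ (Fin n) → ℝ} (hρ : IsChartDensity φ μ ρ)
    {P : EuclideanSpace ℝ (Fin n) → ℝ} (hP : ContDiff ℝ ∞ P)
    (hhom : ∀ (r : ℝ) v, P (r • v) = r ^ k * P v) (hpos : ∀ v, v ≠ 0 → 0 < P v)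
    {ε : ℝ} (hε : ε * ε = 1)
    (hfP : (fun w => ε * f (centeredSymm φ (φ x₀) w) - P w) =O[𝓝 0] fun w => ‖w‖ ^ (k + 1)) :
    ∃ U ∈ 𝓝 x₀, ∀ g : ℝ × X → ℝ, IsSymbol n g → ∀ Θ : X → ℝ, ContMDiff (𝓡 n) 𝓘(ℝ, ℝ) ∞ Θ →
      HasCompactSupport Θ → tsupport Θ ⊆ U → Θ x₀ = 1 →
      (∃ c : ℕ → ℝ, HasAsymptoticExpansion k (singularPart μ f g Θ) c) ∧
      (fun z : ℝ => singularPart μ f g Θ z - z ^ (-(n : ℝ) / k) *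
        (pairingPlus (((n : ℝ) - k) / k) (fun t => g (ε * t, x₀)) * (ρ (φ x₀) * ((1 / (k : ℝ)) *
          ∫ θ : Metric.sphere (0 : EuclideanSpace ℝ (Fin n)) 1, |P θ| ^ (-(n : ℝ) / k)
            ∂(volume : Measure (EuclideanSpace ℝ (Fin n))).toSphere))))
        =O[atTop] fun z : ℝ => z ^ (-((n : ℝ) + 1) / k) := by
  have h0 : (0 : EuclideanSpace ℝ (Fin n)) ∈ centeredTarget φ (φ x₀) := by
    simpa [centeredTarget] using φ.map_source hφx₀
  have hψ0 : centeredSymm φ (φ x₀) 0 = x₀ := by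
    simpa [centeredSymm] using φ.left_inv hφx₀
  obtain ⟨F, R₀, hF, hR₀, hFf⟩ := exists_contDiff_eq_of_contDiffOn isOpen_centeredTarget h0
    (contDiffOn_const.mul (contDiffOn_comp_centeredSymm (y₀ := φ x₀) hφ hf) :
      ContDiffOn ℝ ∞ (fun w => ε * f (centeredSymm φ (φ x₀) w)) _)
  have hFP : (fun w => F w - P w) =O[𝓝 0] fun w => ‖w‖ ^ (k + 1) := by
    refine hfP.congr' ?_ EventuallyEq.rfl
    filter_upwards [Metric.closedBall_mem_nhds (0 : EuclideanSpace ℝ (Fin n)) hR₀] with w hw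
    rw [(hFf w (mem_closedBall_zero_iff.1 hw)).1]
  obtain ⟨R, hR, hRR₀, hmain⟩ := exists_hasAsymptoticExpansion hn hk hF hP hhom hpos hFP hR₀
  -- `R` depends on the phase only, so `U` is chosen before `g` and `Θ`.
  refine ⟨φ.source ∩ φ ⁻¹' Metric.ball (φ x₀) R, inter_mem (φ.open_source.mem_nhds hφx₀)
    ((φ.continuousAt hφx₀).preimage_mem_nhds (Metric.ball_mem_nhds _ hR)),
    fun g hg Θ hΘ hΘc hΘU hΘ1 => ?_⟩
  have hΘs : tsupport Θ ⊆ φ.source := hΘU.trans inter_subset_left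
  have hzero : ∀ t w, R ≤ ‖w‖ → chartAmplitude φ (φ x₀) ρ g Θ ε t w = 0 := fun t w hw => by
    rw [chartAmplitude, chartCutoff_eq_zero, mul_zero]
    rintro ⟨x, hx, hxw⟩
    have h1 : φ x ∈ Metric.ball (φ x₀) R := (hΘU hx).2
    rw [hxw, mem_ball_iff_norm, add_sub_cancel_left] at h1
    exact absurd hw (not_le.2 h1)
  have habs : |ε| = 1 := by
    have : |ε| * |ε| = 1 := by rw [← abs_mul, hε, abs_one]
    nlinarith [abs_nonneg ε]
  have hsing : ∀ z, (∫ w, chartAmplitude φ (φ x₀) ρ g Θ ε (z * F w) w) =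
      singularPart μ f g Θ z := fun z => by
    rw [singularPart_eq_integral_chartAmplitude hρ hf.continuous hg.1.continuous hΘ.continuous
      hΘs hε]
    refine integral_congr_ae (Eventually.of_forall fun w => ?_)
    simp only
    -- `F` is known to equal `ε * f` only for `‖w‖ ≤ R₀`; from radius `R ≤ R₀` on, the amplitude
    -- vanishes.
    rcases le_or_gt R ‖w‖ with hw | hw
    · rw [hzero _ w hw, hzero _ w hw]
    · rw [(hFf w (hw.le.trans hRR₀)).1]
  have hA0 : ∀ t, chartAmplitude φ (φ x₀) ρ g Θ ε t 0 = g (ε * t, x₀) * ρ (φ x₀) := fun t => by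
    rw [chartAmplitude, chartCutoff, indicator_of_mem h0, hψ0, hΘ1, one_mul, add_zero]
  have h := hmain _ (isRapidAmplitude_chartAmplitude hφ hρ.1 hg hΘ hΘc hΘs habs) hzero
  simpa only [hsing, hA0, pairingPlus_mul_const, mul_assoc] using h

end Chart

/-! ### The theorem. -/

theorem theorem1 {n k : ℕ} (hk : 2 ≤ k)
    {X : Type*} [TopologicalSpace X] [T2Space X]
    [ChartedSpace (EuclideanSpace ℝ (Fin n)) X] [IsManifold (𝓡 n) ∞ X]
    [MeasurableSpace X] [BorelSpace X] (μ : Measure X)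
    (f : X → ℝ) (hf : ContMDiff (𝓡 n) 𝓘(ℝ, ℝ) ∞ f)
    (x₀ : X) (hx₀ : f x₀ = 0) (hext : IsLocalExtr f x₀)
    (φ : OpenPartialHomeomorph X (EuclideanSpace ℝ (Fin n)))
    (hφ : φ ∈ IsManifold.maximalAtlas (𝓡 n) ∞ X) (hφx₀ : x₀ ∈ φ.source)
    (ρ : EuclideanSpace ℝ (Fin n) → ℝ) (hρ : IsChartDensity φ μ ρ)
    (p : MvPolynomial (Fin n) ℝ) (hp : HasLeadingJet φ f x₀ k p)
    (hdef : ∀ v : EuclideanSpace ℝ (Fin n), v ≠ 0 → MvPolynomial.eval (fun i => v i) p ≠ 0) :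
    Even k ∧
    Integrable
      (fun θ : Metric.sphere (0 : EuclideanSpace ℝ (Fin n)) 1 =>
        |MvPolynomial.eval (fun i => (θ : EuclideanSpace ℝ (Fin n)) i) p| ^ (-(n : ℝ) / k))
      (volume : Measure (EuclideanSpace ℝ (Fin n))).toSphere ∧
    ∃ U ∈ 𝓝 x₀, ∀ g : ℝ × X → ℝ, IsSymbol n g →
      Integrable (fun t : ℝ => |t| ^ (((n : ℝ) - k) / k) * g (t, x₀)) ∧
      ∀ Θ : X → ℝ, ContMDiff (𝓡 n) 𝓘(ℝ, ℝ) ∞ Θ → HasCompactSupport Θ → tsupport Θ ⊆ U →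
        (∀ᶠ x in 𝓝 x₀, Θ x = 1) →
        (∃ c : ℕ → ℝ, HasAsymptoticExpansion k (singularPart μ f g Θ) c) ∧
        (IsLocalMin f x₀ →
          (fun z : ℝ => singularPart μ f g Θ z -
              z ^ (-(n : ℝ) / k) *
                (pairingPlus (((n : ℝ) - k) / k) (fun t => g (t, x₀)) *
                  (ρ (φ x₀) * ((1 / (k : ℝ)) * sphereIntegral k p))))
            =O[atTop] fun z : ℝ => z ^ (-((n : ℝ) + 1) / k)) ∧
        (IsLocalMax f x₀ →
          (fun z : ℝ => singularPart μ f g Θ z -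
              z ^ (-(n : ℝ) / k) *
                (pairingMinus (((n : ℝ) - k) / k) (fun t => g (t, x₀)) *
                  (ρ (φ x₀) * ((1 / (k : ℝ)) * sphereIntegral k p))))
            =O[atTop] fun z : ℝ => z ^ (-((n : ℝ) + 1) / k)) := by
  have hk0 : k ≠ 0 := by omega
  obtain ⟨hphom, hp0, hjet⟩ := hp
  have hn : n ≠ 0 := hphom.ne_zero_of_pos hp0 hk0
  have : NeZero n := ⟨hn⟩
  set P : EuclideanSpace ℝ (Fin n) → ℝ := fun v => MvPolynomial.eval (fun i => v i) p with hPdef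
  have hP : ContDiff ℝ ∞ P := contDiff_mvPolynomial_eval p
  have hhom : ∀ (r : ℝ) v, P (r • v) = r ^ k * P v := hphom.eval_smul_vec
  have hψ0 : centeredSymm φ (φ x₀) 0 = x₀ := by
    simpa [centeredSymm] using φ.left_inv hφx₀
  have hψ : Tendsto (centeredSymm φ (φ x₀)) (𝓝 0) (𝓝 x₀) := by
    have h0 : (0 : EuclideanSpace ℝ (Fin n)) ∈ centeredTarget φ (φ x₀) := by
      simpa [centeredTarget] using φ.map_source hφx₀
    have := ((contMDiffOn_centeredSymm (y₀ := φ x₀) hφ).continuousOn.continuousAt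
      (isOpen_centeredTarget.mem_nhds h0)).tendsto
    rwa [hψ0] at this
  have hfP : (fun w => f (centeredSymm φ (φ x₀) w) - P w) =O[𝓝 0] fun w => ‖w‖ ^ (k + 1) := by
    have ht : Tendsto (fun w : EuclideanSpace ℝ (Fin n) => φ x₀ + w) (𝓝 0) (𝓝 (φ x₀)) := by
      have : Continuous fun w : EuclideanSpace ℝ (Fin n) => φ x₀ + w := by fun_prop
      simpa using this.tendsto 0
    simpa [Function.comp_def, centeredSymm] using hjet.comp_tendsto ht
  have hnfP : (fun w => -f (centeredSymm φ (φ x₀) w) - -P w) =O[𝓝 0] fun w => ‖w‖ ^ (k + 1) :=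
    hfP.neg_left.congr_left fun w => by ring
  have hnhom : ∀ (r : ℝ) v, -P (r • v) = r ^ k * -P v := fun r v => by rw [hhom]; ring
  -- The minimum makes the leading part nonnegative, and definiteness makes it positive.
  have hpos : IsLocalMin f x₀ → ∀ v, v ≠ 0 → 0 < P v := fun hmin v hv =>
    (leadingPart_nonneg hhom hfP (by
      filter_upwards [hψ.eventually hmin] with w hw
      rwa [hx₀] at hw) v).lt_of_ne (hdef v hv).symm
  have hneg : IsLocalMax f x₀ → ∀ v, v ≠ 0 → 0 < -P v := fun hmax v hv =>
    (leadingPart_nonneg (P := fun v => -P v) hnhom hnfP (by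
      filter_upwards [hψ.eventually hmax] with w hw
      rw [hx₀] at hw
      exact neg_nonneg.2 hw) v).lt_of_ne (neg_ne_zero.2 (hdef v hv)).symm
  obtain ⟨v₀, hv₀⟩ := exists_ne (0 : EuclideanSpace ℝ (Fin n))
  have heven : Even k := by
    by_contra hodd
    have hsym : P (-v₀) = -P v₀ := by
      have := hhom (-1) v₀
      rwa [neg_one_smul, (Nat.not_even_iff_odd.1 hodd).neg_one_pow, neg_one_mul] at this
    have hv₀' := neg_ne_zero.2 hv₀
    rcases hext with h | h
    · linarith [hpos h _ hv₀, hpos h _ hv₀']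
    · linarith [hneg h _ hv₀, hneg h _ hv₀']
  refine ⟨heven, ?_, ?_⟩
  · have hc : Continuous fun θ : Metric.sphere (0 : EuclideanSpace ℝ (Fin n)) 1 =>
        |P θ| ^ (-(n : ℝ) / k) :=
      (hP.continuous.comp continuous_subtype_val).abs.rpow_const fun θ =>
        Or.inl (abs_ne_zero.2 (hdef _ (ne_zero_of_mem_unit_sphere θ)))
    exact hc.integrable_of_hasCompactSupport (HasCompactSupport.of_compactSpace _)
  have hpair : ∀ g : ℝ × X → ℝ, IsSymbol n g →
      Integrable (fun t : ℝ => |t| ^ (((n : ℝ) - k) / k) * g (t, x₀)) := fun g hg => by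
    refine integrable_abs_rpow_mul hn hk0
      (hg.1.continuous.comp (continuous_id.prodMk continuous_const)) fun N => ?_
    -- Decay of `g(t, x₀)` is the symbol estimate without derivatives on the compact set `{φ x₀}`.
    obtain ⟨C, hC⟩ := exists_one_add_pow_bound (s := univ) (u := fun t (_ : Unit) => |g (t, x₀)|)
      (fun _ _ => abs_nonneg _) (fun N => by
        obtain ⟨C, hC⟩ := hg.2 φ hφ {φ x₀} isCompact_singleton
          (singleton_subset_iff.2 (φ.map_source hφx₀)) N 0
        refine ⟨C, fun t _ _ => ?_⟩
        have := hC t _ rfl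
        rwa [norm_iteratedFDeriv_zero, φ.left_inv hφx₀] at this) N
    exact ⟨C, fun t => hC t () (mem_univ _)⟩
  rcases hext with h | h
  · obtain ⟨U, hU, hmain⟩ := exists_nhds_singularPart_expansion hn hk0 hf hφ hφx₀ hρ hP hhom
      (hpos h) (ε := 1) (by norm_num) (by simpa only [one_mul] using hfP)
    refine ⟨U, hU, fun g hg => ⟨hpair g hg, fun Θ hΘ hΘc hΘU hΘ1 => ?_⟩⟩
    obtain ⟨hexp, hlead⟩ := hmain g hg Θ hΘ hΘc hΘU hΘ1.self_of_nhds
    refine ⟨hexp, fun _ => ?_, fun hmax => ?_⟩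
    · simp only [one_mul] at hlead
      exact hlead
    -- `x₀` cannot be both a minimum and a maximum, since `P v₀` would be positive and negative.
    · linarith [hpos h _ hv₀, hneg hmax _ hv₀]
  · obtain ⟨U, hU, hmain⟩ := exists_nhds_singularPart_expansion hn hk0 hf hφ hφx₀ hρ hP.neg hnhom
      (hneg h) (ε := -1) (by norm_num) (by simpa only [neg_one_mul] using hnfP)
    refine ⟨U, hU, fun g hg => ⟨hpair g hg, fun Θ hΘ hΘc hΘU hΘ1 => ?_⟩⟩
    obtain ⟨hexp, hlead⟩ := hmain g hg Θ hΘ hΘc hΘU hΘ1.self_of_nhds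
    refine ⟨hexp, fun hmin => ?_, fun _ => ?_⟩
    · linarith [hpos hmin _ hv₀, hneg h _ hv₀]
    · simp only [neg_one_mul, abs_neg] at hlead
      simp only [pairingMinus_eq]
      exact hlead
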